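/- **Setting.** Let $d\ge 2$ and $n\ge 1$ be integers. $\mathcal S(\mathcal H)$ denotes the set of positive semidefinite operators of unit trace on a finite-dimensional Hilbert space $\mathcal H$, and $\mathcal H_d=\mathbb C^d$. Let $\Phi$ be a quantum channel on $\mathcal H_d$ (a completely positive, trace preserving linear map on $d\times d$ matrices), let $\tau=(\Phi\otimes\mathrm{id})(|\Omega\rangle\langle\Omega|)$ with $|\Omega\rangle=\frac1{\sqrt d}\sum_{i=1}^d|i\,i\rangle$ be its Choi state, $\pi=\Phi(\mathbb I/d)$, and let $\mathrm{Tr}_2$ be the partial trace over the second factor. A unitary $2$-design is a probability distribution on a unitary group under which every polynomial of degree at most $2$ in the entries of $U$ and at most $2$ in the entries of $U^\dagger$ has the same expectation as under the Haar probability measure. Let $\nu$ be a $2$-design over pure states in $\mathcal S(\mathcal H_d^{\otimes n})$, i.e. the distribution of the pure state of $U|\phi_0\rangle$ for some fixed unit vector $|\phi_0\rangle$ and $U$ distributed according to some unitary $2$-design. Let $\nu^{(2)}$ be the distribution of $(\rho,\sigma)\sim\nu\times\nu$ conditioned on $\rho\ne\sigma$. For a channel $T$, the average contraction of the trace distance is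 $$\eta_1(T,\|\cdot\|_1,\nu^{(2)})=\mathbb E_{(\rho,\sigma)\sim\nu^{(2)}}\left[\frac{\frac12\|T(\rho)-T(\sigma)\|_1}{\frac12\|\rho-\sigma\|_1}\right],$$ where $\|\cdot\|_1$ is the trace norm (the sum of the singular values). **Statement.** The conditional distribution $\nu^{(2)}$ is a well-defined probability measure, the ratio above is integrable with respect to it, and the operator $d^n(\mathrm{Tr}_2\tau^2)^{\otimes n}-(\pi^2)^{\otimes n}$ is positive semidefinite. Moreover there is an absolute constant $C$ (independent of $d$, $n$, $\Phi$ and $\nu$) such that, for all such $d,n,\Phi,\nu$, $$\eta_1(\Phi^{\otimes n},\|\cdot\|_1,\nu^{(2)})\le \frac12\,\mathrm{Tr}\left(\frac{2}{d^n+1}\left[d^n(\mathrm{Tr}_2\tau^2)^{\otimes n}-(\pi^2)^{\otimes n}\right]\right)^{1/2}+\frac{C}{\sqrt{d^n}}$$ and $$\eta_1(\Phi^{\otimes n},\|\cdot\|_1,\nu^{(2)})\le\frac1{\sqrt2}\left(\mathrm{Tr}\sqrt{\mathrm{Tr}_2\tau^2}\right)^n+\frac{C}{\sqrt{d^n}}.$$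 Consequently, if $\mathrm{Tr}\sqrt{\mathrm{Tr}_2\tau^2}<1$, then the average contraction decays exponentially in $n$: there are constants $K$ and $0<c<1$, depending only on $d$ and $\Phi$, such that $\eta_1(\Phi^{\otimes n},\|\cdot\|_1,\nu^{(2)})\le K c^n$ for every $n\ge1$ and every $2$-design $\nu$ over pure states in $\mathcal S(\mathcal H_d^{\otimes n})$. -/

import Mathlib

open MeasureTheory
open scoped ComplexOrder MatrixOrder

noncomputable section

namespace QContraction

/-! ### States, trace norm, traces of square roots -/

/-- The quantum states on the Hilbert space with orthonormal basis indexed by `ι`: positive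
semidefinite matrices of unit trace. For `ι = Fin d` this is `S(H_d)`, and for `ι = Fin n → Fin d`
it is `S(H_d^{⊗ n})`, the basis vector with index `a` being `e_{a 0} ⊗ ⋯ ⊗ e_{a (n-1)}`. -/
abbrev QState (ι : Type) [Fintype ι] : Type :=
  {ρ : Matrix ι ι ℂ // ρ.PosSemidef ∧ ρ.trace = 1}

instance (ι : Type) [Fintype ι] : MeasurableSpace (QState ι) := borel _

instance (ι : Type) [Fintype ι] : BorelSpace (QState ι) := ⟨rfl⟩

/-- The trace norm (Schatten 1-norm): the sum of the singular values, that is, of the square roots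
of the eigenvalues of `Xᴴ X`. -/
def traceNorm {ι : Type} [Fintype ι] [DecidableEq ι] (X : Matrix ι ι ℂ) : ℝ :=
  ∑ i, √((Matrix.isHermitian_conjTranspose_mul_self X).eigenvalues i)

/-- The trace distance `(1/2) ‖X - Y‖₁`. -/
def traceDist {ι : Type} [Fintype ι] [DecidableEq ι] (X Y : Matrix ι ι ℂ) : ℝ :=
  1 / 2 * traceNorm (X - Y)

/-- `Tr √A` for a positive semidefinite matrix `A`, with the square root of the continuous
functional calculus. -/
def traceSqrt {ι : Type} [Fintype ι] [DecidableEq ι] (A : Matrix ι ι ℂ) : ℝ :=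
  (CFC.sqrt A).trace.re

/-! ### Channels -/

/-- `T ⊗ id` on matrices over the tensor product with a second system with basis indexed by `r`. -/
def ampliation {ι κ : Type} (r : Type) (T : Matrix ι ι ℂ →ₗ[ℂ] Matrix κ κ ℂ)
    (X : Matrix (ι × r) (ι × r) ℂ) : Matrix (κ × r) (κ × r) ℂ :=
  Matrix.of fun p q => T (Matrix.of fun i j => X (i, p.2) (j, q.2)) p.1 q.1

/-- Complete positivity: `T ⊗ id_k` preserves positive semidefiniteness for every `k`. -/
def IsCompletelyPositive {ι κ : Type} (T : Matrix ι ι ℂ →ₗ[ℂ] Matrix κ κ ℂ) : Prop :=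
  ∀ (k : ℕ) (X : Matrix (ι × Fin k) (ι × Fin k) ℂ), X.PosSemidef →
    (ampliation (Fin k) T X).PosSemidef

/-- Quantum channels: completely positive and trace preserving linear maps. -/
structure IsQuantumChannel {ι κ : Type} [Fintype ι] [Fintype κ]
    (T : Matrix ι ι ℂ →ₗ[ℂ] Matrix κ κ ℂ) : Prop where
  completelyPositive : IsCompletelyPositive T
  tracePreserving : ∀ X : Matrix ι ι ℂ, (T X).trace = X.trace

/-- The maximally entangled unit vector `Ω = d^{-1/2} ∑ i, e_i ⊗ e_i`. -/
def maxEntangled (ι : Type) [Fintype ι] [DecidableEq ι] : ι × ι → ℂ :=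
  fun p => if p.1 = p.2 then ((1 / √(Fintype.card ι : ℝ) : ℝ) : ℂ) else 0

/-- The Choi state `τ(T) = (T ⊗ id)(|Ω⟩⟨Ω|)`. -/
def choiState {ι κ : Type} [Fintype ι] [DecidableEq ι]
    (T : Matrix ι ι ℂ →ₗ[ℂ] Matrix κ κ ℂ) : Matrix (κ × ι) (κ × ι) ℂ :=
  ampliation ι T (Matrix.vecMulVec (maxEntangled ι) (star (maxEntangled ι)))

/-- The average output state `π(T) = T(I / d)`. -/
def averageOutput {ι κ : Type} [Fintype ι] [DecidableEq ι]
    (T : Matrix ι ι ℂ →ₗ[ℂ] Matrix κ κ ℂ) : Matrix κ κ ℂ :=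
  T ((Fintype.card ι : ℂ)⁻¹ • (1 : Matrix ι ι ℂ))

/-- The partial trace `Tr₂` over the second tensor factor. -/
def partialTrace₂ {κ ι : Type} [Fintype ι] (X : Matrix (κ × ι) (κ × ι) ℂ) : Matrix κ κ ℂ :=
  Matrix.of fun a b => ∑ i, X (a, i) (b, i)

/-- The tensor product `A 0 ⊗ ⋯ ⊗ A (n-1)` of matrices. -/
def tensorProd {n : ℕ} {ι κ : Type} (A : Fin n → Matrix ι κ ℂ) :
    Matrix (Fin n → ι) (Fin n → κ) ℂ :=
  Matrix.of fun a b => ∏ k, A k (a k) (b k)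

/-- The tensor power `A^{⊗ n}` of a matrix. -/
def tensorPow (n : ℕ) {ι κ : Type} (A : Matrix ι κ ℂ) : Matrix (Fin n → ι) (Fin n → κ) ℂ :=
  tensorProd fun _ => A

/-- The tensor power `Φ^{⊗ n}` of a linear map on matrices: the linear map that sends the matrix
unit `E_{ij} = E_{i_1 j_1} ⊗ ⋯ ⊗ E_{i_n j_n}` to `Φ(E_{i_1 j_1}) ⊗ ⋯ ⊗ Φ(E_{i_n j_n})`. -/
def channelPow (n : ℕ) {ι κ : Type} [Fintype ι] [DecidableEq ι]
    (Φ : Matrix ι ι ℂ →ₗ[ℂ] Matrix κ κ ℂ) :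
    Matrix (Fin n → ι) (Fin n → ι) ℂ →ₗ[ℂ] Matrix (Fin n → κ) (Fin n → κ) ℂ where
  toFun X := ∑ i : Fin n → ι, ∑ j : Fin n → ι,
    X i j • tensorProd fun k => Φ (Matrix.single (i k) (j k) 1)
  map_add' X Y := by simp [add_smul, Finset.sum_add_distrib]
  map_smul' c X := by simp [Finset.smul_sum, mul_smul]

/-- The defining property of `Φ^{⊗ n}` on product operators. -/
theorem channelPow_tensorProd (n : ℕ) {ι κ : Type} [Fintype ι] [DecidableEq ι]
    (Φ : Matrix ι ι ℂ →ₗ[ℂ] Matrix κ κ ℂ) (A : Fin n → Matrix ι ι ℂ) :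
    channelPow n Φ (tensorProd A) = tensorProd fun k => Φ (A k) := by
  have h : ∀ X : Matrix ι ι ℂ, Φ X = ∑ p : ι × ι, X p.1 p.2 • Φ (Matrix.single p.1 p.2 1) := by
    intro X
    conv_lhs => rw [Matrix.matrix_eq_sum_single X]
    simp only [map_sum]
    rw [Fintype.sum_prod_type]
    refine Finset.sum_congr rfl fun i _ => Finset.sum_congr rfl fun j _ => ?_
    rw [← map_smul, Matrix.smul_single, smul_eq_mul, mul_one]
  ext a b
  simp only [channelPow, tensorProd, LinearMap.coe_mk, AddHom.coe_mk, Matrix.sum_apply,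
    Matrix.smul_apply, Matrix.of_apply, smul_eq_mul]
  simp_rw [h (A _), Matrix.sum_apply, Matrix.smul_apply, smul_eq_mul]
  rw [Finset.prod_univ_sum, Fintype.piFinset_univ, ← Fintype.sum_prod_type']
  refine Fintype.sum_equiv (Equiv.arrowProdEquivProdArrow (Fin n) (fun _ => ι) (fun _ => ι)).symm
    _ _ fun p => ?_
  simp [Finset.prod_mul_distrib, Equiv.arrowProdEquivProdArrow]

/-! ### Designs -/

instance (ι : Type) [Fintype ι] [DecidableEq ι] :
    MeasurableSpace (Matrix.unitaryGroup ι ℂ) := borel _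

instance (ι : Type) [Fintype ι] [DecidableEq ι] : BorelSpace (Matrix.unitaryGroup ι ℂ) := ⟨rfl⟩

instance (ι : Type) [Fintype ι] [DecidableEq ι] : CompactSpace (Matrix.unitaryGroup ι ℂ) := by
  refine isCompact_iff_compactSpace (s := (Matrix.unitaryGroup ι ℂ : Set (Matrix ι ι ℂ))).mp ?_
  refine IsCompact.of_isClosed_subset
    (isCompact_univ_pi fun _ : ι => isCompact_univ_pi fun _ : ι =>
      isCompact_closedBall (0 : ℂ) 1) ?_ ?_
  · have : ((Matrix.unitaryGroup ι ℂ : Submonoid (Matrix ι ι ℂ)) : Set (Matrix ι ι ℂ)) =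
        {U | U * star U = 1} := by
      ext U
      exact Matrix.mem_unitaryGroup_iff
    rw [this]
    exact isClosed_eq (by fun_prop) continuous_const
  · intro U hU i _ j _
    simpa using entry_norm_bound_of_unitary hU i j

/-- The Haar probability measure on the unitary group. -/
def haarUnitary (ι : Type) [Fintype ι] [DecidableEq ι] : Measure (Matrix.unitaryGroup ι ℂ) :=
  Measure.haarMeasure ⊤

/-- The value at `U` of a polynomial in the entries of `U` (the variables `inl (i, j)`) and of
`U†` (the variables `inr (i, j)`). -/
def evalUnitary {ι : Type} [Fintype ι] [DecidableEq ι]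
    (P : MvPolynomial ((ι × ι) ⊕ (ι × ι)) ℂ) (U : Matrix.unitaryGroup ι ℂ) : ℂ :=
  MvPolynomial.eval
    (Sum.elim (fun p => (U : Matrix ι ι ℂ) p.1 p.2)
      (fun p => (star (U : Matrix ι ι ℂ)) p.1 p.2)) P

/-- The polynomial has degree at most `t` in the entries of `U` and degree at most `t` in the
entries of `U†`. -/
def HasBidegreeLE {ι : Type} [Fintype ι] (t : ℕ)
    (P : MvPolynomial ((ι × ι) ⊕ (ι × ι)) ℂ) : Prop :=
  ∀ m ∈ P.support, ∑ p : ι × ι, m (Sum.inl p) ≤ t ∧ ∑ p : ι × ι, m (Sum.inr p) ≤ t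

/-- Unitary `t`-designs: probability distributions on the unitary group that give every polynomial
of degree at most `t` in the entries of `U` and in those of `U†` its Haar average. -/
structure IsUnitaryDesign {ι : Type} [Fintype ι] [DecidableEq ι] (t : ℕ)
    (μ : Measure (Matrix.unitaryGroup ι ℂ)) : Prop where
  isProbabilityMeasure : IsProbabilityMeasure μ
  average : ∀ P : MvPolynomial ((ι × ι) ⊕ (ι × ι)) ℂ, HasBidegreeLE t P →
    ∫ U, evalUnitary P U ∂μ = ∫ U, evalUnitary P U ∂(haarUnitary ι)

/-- The pure state `|φ⟩⟨φ|` of a unit vector `φ`. -/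
def pureState {ι : Type} [Fintype ι] (φ : EuclideanSpace ℂ ι) (hφ : ‖φ‖ = 1) : QState ι :=
  ⟨Matrix.vecMulVec φ (star (φ : ι → ℂ)), Matrix.posSemidef_vecMulVec_self_star _, by
    have h := EuclideanSpace.norm_sq_eq φ
    rw [hφ] at h
    rw [Matrix.trace_vecMulVec, dotProduct]
    simp only [Pi.star_apply, RCLike.star_def, Complex.mul_conj, Complex.normSq_eq_norm_sq]
    exact_mod_cast h.symm.trans (by norm_num)⟩

/-- The state `U ρ U†`. For `ρ = |φ⟩⟨φ|` this is the pure state of the vector `U φ`. -/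
def conjState {ι : Type} [Fintype ι] [DecidableEq ι] (U : Matrix.unitaryGroup ι ℂ)
    (ρ : QState ι) : QState ι :=
  ⟨(U : Matrix ι ι ℂ) * ρ.1 * star (U : Matrix ι ι ℂ), by
    refine ⟨ρ.2.1.mul_mul_conjTranspose_same _, ?_⟩
    rw [Matrix.trace_mul_cycle, Matrix.UnitaryGroup.star_mul_self, Matrix.one_mul, ρ.2.2]⟩

theorem measurable_conjState {ι : Type} [Fintype ι] [DecidableEq ι] (ρ : QState ι) :
    Measurable fun U : Matrix.unitaryGroup ι ℂ => conjState U ρ := by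
  refine Continuous.measurable (Continuous.subtype_mk ?_ _)
  fun_prop

/-- `ν` is a `t`-design over pure states: it is the distribution of (the pure state of) `U φ₀`, for
some reference unit vector `φ₀` and `U` distributed according to some unitary `t`-design. -/
def IsStateDesign {ι : Type} [Fintype ι] [DecidableEq ι] (t : ℕ) (ν : Measure (QState ι)) : Prop :=
  ∃ (φ₀ : EuclideanSpace ℂ ι) (h₀ : ‖φ₀‖ = 1) (μ : Measure (Matrix.unitaryGroup ι ℂ)),
    IsUnitaryDesign t μ ∧ ν = μ.map fun U => conjState U (pureState φ₀ h₀)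

/-! ### Average contraction -/

/-- `ν^{(2)}`: the distribution of `(ρ, σ) ∼ ν × ν` conditioned on `ρ ≠ σ`. -/
def pairDistribution {ι : Type} [Fintype ι] (ν : Measure (QState ι)) :
    Measure (QState ι × QState ι) :=
  ProbabilityTheory.cond (ν.prod ν) {p | p.1 ≠ p.2}

/-- The ratio of the trace distances after and before the application of `T`. -/
def contractionRatio {ι κ : Type} [Fintype ι] [DecidableEq ι] [Fintype κ] [DecidableEq κ]
    (T : Matrix ι ι ℂ →ₗ[ℂ] Matrix κ κ ℂ) (p : QState ι × QState ι) : ℝ :=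
  traceDist (T p.1.1) (T p.2.1) / traceDist p.1.1 p.2.1

/-- The average contraction of the trace distance `η₁(T, ‖·‖₁, ω)`: the expectation of the
contraction ratio for `(ρ, σ) ∼ ω`. -/
def avgContraction {ι κ : Type} [Fintype ι] [DecidableEq ι] [Fintype κ] [DecidableEq κ]
    (T : Matrix ι ι ℂ →ₗ[ℂ] Matrix κ κ ℂ) (ω : Measure (QState ι × QState ι)) : ℝ :=
  ∫ p, contractionRatio T p ∂ω

end QContraction

end

open QContraction

/-!
Write `D` for the dimension. For independent `ρ, σ ∼ ν` the second moments of a 2-design give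
`E[T(ρ - σ)²] = 2 / (D + 1) • (D • Tr₂ τ(T)² - π(T)²)`, and since `‖X‖₁ = Tr √(X²)` for Hermitian
`X`, Jensen's inequality for the concave function `Tr √·` bounds `E ‖T(ρ - σ)‖₁`.

Dividing by `½ ‖ρ - σ‖₁` costs little, since random pure states are almost orthogonal:
`1 - Tr(ρ σ) ≤ ½ ‖ρ - σ‖₁ ≤ 1` with `E[Tr(ρ σ)] = 1 / D`. Conditioning on `ρ ≠ σ` costs at most
`P(ρ = σ) ≤ E[Tr(ρ σ)] = 1 / D` more, so the total error is `2 / D`.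

Finally `(D • Tr₂ τ² - π²) / (D + 1) ≤ Tr₂ τ²`, and `Tr √·` is monotone and multiplicative on tensor
powers. The key to both concavity and monotonicity of `Tr √·` is the variational formula
`Tr √M = inf_{S > 0} ½ (Tr(S⁻¹ M) + Tr S)`.
-/

namespace QContraction

section Trace

variable {ι 𝕜 : Type*} [Fintype ι] [RCLike 𝕜] {A B : Matrix ι ι 𝕜}

theorem trace_mul_nonneg (hA : A.PosSemidef) (hB : B.PosSemidef) : 0 ≤ (A * B).trace := by
  classical
  obtain ⟨C, rfl⟩ := CStarAlgebra.nonneg_iff_eq_star_mul_self.mp hA.nonneg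
  rw [Matrix.mul_assoc, Matrix.trace_mul_comm]
  exact (hB.mul_mul_conjTranspose_same C).trace_nonneg

theorem trace_mul_le_trace_mul {C : Matrix ι ι 𝕜} (hA : A.PosSemidef) (hBC : B ≤ C) :
    (A * B).trace ≤ (A * C).trace := by
  rw [← sub_nonneg, ← Matrix.trace_sub, ← Matrix.mul_sub]
  exact trace_mul_nonneg hA (Matrix.le_iff.mp hBC)

theorem trace_cfc [DecidableEq ι] (hA : A.IsHermitian) (f : ℝ → ℝ) :
    (cfc f A).trace = ∑ i, (f (hA.eigenvalues i) : 𝕜) := by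
  rw [hA.cfc_eq, Matrix.IsHermitian.cfc, Unitary.conjStarAlgAut_apply, Matrix.trace_mul_cycle,
    Unitary.coe_star_mul_self, Matrix.one_mul, Matrix.trace_diagonal]
  rfl

end Trace

section TraceSqrt

variable {ι : Type} [Fintype ι] [DecidableEq ι] {M N : Matrix ι ι ℂ}

theorem traceSqrt_eq_sum (hM : M.PosSemidef) : traceSqrt M = ∑ i, √(hM.1.eigenvalues i) := by
  rw [traceSqrt, CFC.sqrt_eq_real_sqrt M hM.nonneg, cfcₙ_eq_cfc, trace_cfc hM.1, Complex.re_sum]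
  rfl

theorem traceSqrt_nonneg (M : Matrix ι ι ℂ) : 0 ≤ traceSqrt M :=
  (Complex.le_def.mp (Matrix.nonneg_iff_posSemidef.mp (CFC.sqrt_nonneg M)).trace_nonneg).1

theorem traceSqrt_smul {c : ℝ} (hc : 0 ≤ c) (hM : M.PosSemidef) :
    traceSqrt (c • M) = √c * traceSqrt M := by
  have hsqrt : CFC.sqrt (c • M) = √c • CFC.sqrt M := by
    refine CFC.sqrt_unique ?_ (smul_nonneg (Real.sqrt_nonneg c) (CFC.sqrt_nonneg M))
    rw [smul_mul_smul_comm, Real.mul_self_sqrt hc, CFC.sqrt_mul_sqrt_self M hM.nonneg]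
  rw [traceSqrt, hsqrt, Matrix.trace_smul, Complex.smul_re, smul_eq_mul, traceSqrt]

/-- The function of `S` whose infimum over the positive definite matrices is `Tr √M`. It is affine
in `M`, which makes monotonicity and concavity of `traceSqrt` evident. -/
noncomputable def sqrtBound (M S : Matrix ι ι ℂ) : ℝ :=
  ((S⁻¹ * M).trace.re + S.trace.re) / 2

theorem traceSqrt_le_sqrtBound {S : Matrix ι ι ℂ} (hM : M.PosSemidef) (hS : S.PosDef) :
    traceSqrt M ≤ sqrtBound M S := by
  set R := CFC.sqrt M with hRM
  have hR : R.PosSemidef := Matrix.nonneg_iff_posSemidef.mp (CFC.sqrt_nonneg M)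
  have hu : IsUnit S.det := (Matrix.isUnit_iff_isUnit_det _).mp hS.isUnit
  have hexpand : S⁻¹ * ((R - S) * (R - S)) = S⁻¹ * (R * R) - S⁻¹ * R * S - S⁻¹ * S * R
      + S⁻¹ * S * S := by
    noncomm_ring
  have htrace : 0 ≤ (S⁻¹ * ((R - S) * (R - S))).trace := by
    refine trace_mul_nonneg hS.inv.posSemidef ?_
    simpa only [(hR.1.sub hS.1).eq] using Matrix.posSemidef_conjTranspose_mul_self (R - S)
  rw [hexpand, Matrix.nonsing_inv_mul _ hu, Matrix.one_mul, Matrix.one_mul, Matrix.trace_add,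
    Matrix.trace_sub, Matrix.trace_sub, Matrix.trace_mul_cycle, Matrix.mul_nonsing_inv _ hu,
    Matrix.one_mul, CFC.sqrt_mul_sqrt_self M hM.nonneg] at htrace
  have hre := (Complex.le_def.mp htrace).1
  simp only [Complex.add_re, Complex.sub_re, Complex.zero_re] at hre
  rw [traceSqrt, sqrtBound, ← hRM]
  linarith

theorem sqrtBound_le_trace {S : Matrix ι ι ℂ} (hS : S.PosDef) (h : M ≤ S * S) :
    sqrtBound M S ≤ S.trace.re := by
  have hle := (Complex.le_def.mp (trace_mul_le_trace_mul hS.inv.posSemidef h)).1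
  rw [← Matrix.mul_assoc, Matrix.nonsing_inv_mul _ ((Matrix.isUnit_iff_isUnit_det _).mp hS.isUnit),
    Matrix.one_mul] at hle
  rw [sqrtBound]
  linarith

theorem isGLB_traceSqrt (hM : M.PosSemidef) :
    IsGLB (sqrtBound M '' {S | S.PosDef}) (traceSqrt M) := by
  refine ⟨Set.forall_mem_image.mpr fun S hS => traceSqrt_le_sqrtBound hM hS, fun x hx => ?_⟩
  set R := CFC.sqrt M with hRM
  have hR : R.PosSemidef := Matrix.nonneg_iff_posSemidef.mp (CFC.sqrt_nonneg M)
  have hbound : ∀ ε : ℝ, 0 < ε → x ≤ traceSqrt M + ε * Fintype.card ι := fun ε hε => by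
    set S := R + ε • (1 : Matrix ι ι ℂ) with hSR
    have hS : S.PosDef := Matrix.PosDef.posSemidef_add hR (Matrix.PosDef.one.smul hε)
    have hsq : S * S = R * R + ((2 * ε) • R + (ε * ε) • (1 : Matrix ι ι ℂ)) := by
      rw [hSR, add_mul, mul_add, mul_add, smul_mul_smul_comm, mul_smul_comm, smul_mul_assoc,
        one_mul, mul_one, mul_one]
      module
    have hMS : M ≤ S * S := by
      rw [hsq, CFC.sqrt_mul_sqrt_self M hM.nonneg]
      exact le_add_of_nonneg_right ((hR.smul (by positivity)).add
        (Matrix.PosSemidef.one.smul (by positivity))).nonneg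
    calc x ≤ sqrtBound M S := hx ⟨S, hS, rfl⟩
      _ ≤ S.trace.re := sqrtBound_le_trace hS hMS
      _ = traceSqrt M + ε * Fintype.card ι := by simp [hSR, traceSqrt, hRM]
  refine ge_of_tendsto (f := fun ε : ℝ => traceSqrt M + ε * Fintype.card ι)
    (x := nhdsWithin 0 (Set.Ioi 0)) ?_ (eventually_mem_nhdsWithin.mono hbound)
  exact Continuous.tendsto' (by fun_prop) _ _ (by simp) |>.mono_left nhdsWithin_le_nhds

theorem traceSqrt_mono (hM : M.PosSemidef) (hMN : M ≤ N) : traceSqrt M ≤ traceSqrt N := by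
  have hN : N.PosSemidef := Matrix.nonneg_iff_posSemidef.mp (hM.nonneg.trans hMN)
  refine (isGLB_traceSqrt hN).2 (Set.forall_mem_image.mpr fun S hS => ?_)
  have hle := (Complex.le_def.mp (trace_mul_le_trace_mul hS.inv.posSemidef hMN)).1
  refine (traceSqrt_le_sqrtBound hM hS).trans ?_
  rw [sqrtBound, sqrtBound]
  linarith

theorem concaveOn_traceSqrt : ConcaveOn ℝ {M : Matrix ι ι ℂ | 0 ≤ M} traceSqrt := by
  refine ⟨convex_Ici 0, fun M hM N hN a b ha hb hab => ?_⟩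
  replace hM := Matrix.nonneg_iff_posSemidef.mp hM
  replace hN := Matrix.nonneg_iff_posSemidef.mp hN
  have hMN : (a • M + b • N).PosSemidef := (hM.smul ha).add (hN.smul hb)
  refine (isGLB_traceSqrt hMN).2 (Set.forall_mem_image.mpr fun S hS => ?_)
  have haffine : sqrtBound (a • M + b • N) S = a * sqrtBound M S + b * sqrtBound N S := by
    simp only [sqrtBound, mul_add, Matrix.mul_smul, Matrix.trace_add, Matrix.trace_smul,
      Complex.add_re, Complex.smul_re, smul_eq_mul]
    linear_combination (-(S.trace.re / 2)) * hab
  rw [haffine, smul_eq_mul, smul_eq_mul]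
  exact add_le_add (mul_le_mul_of_nonneg_left (traceSqrt_le_sqrtBound hM hS) ha)
    (mul_le_mul_of_nonneg_left (traceSqrt_le_sqrtBound hN hS) hb)

open scoped Matrix.Norms.L2Operator in
theorem continuousOn_traceSqrt : ContinuousOn traceSqrt {M : Matrix ι ι ℂ | 0 ≤ M} :=
  Complex.continuous_re.comp_continuousOn
    (continuous_id.matrix_trace.comp_continuousOn CFC.continuousOn_sqrt)

open scoped Matrix.Norms.L2Operator in
theorem integral_traceSqrt_le {Ω : Type*} [MeasurableSpace Ω] {μ : Measure Ω}
    [IsProbabilityMeasure μ] {Y : Ω → Matrix ι ι ℂ} (hY : Integrable Y μ)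
    (hsqrt : Integrable (fun ω => traceSqrt (Y ω)) μ) (hpos : ∀ᵐ ω ∂μ, 0 ≤ Y ω) :
    ∫ ω, traceSqrt (Y ω) ∂μ ≤ traceSqrt (∫ ω, Y ω ∂μ) := by
  have hconcave : ConcaveOn ℝ {M : Matrix ι ι ℂ | 0 ≤ M} traceSqrt := concaveOn_traceSqrt
  have hclosed : IsClosed {M : Matrix ι ι ℂ | 0 ≤ M} := CStarAlgebra.isClosed_nonneg
  exact ConcaveOn.le_map_integral hconcave continuousOn_traceSqrt hclosed hpos hY hsqrt

end TraceSqrt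

section TraceNorm

variable {ι : Type} [Fintype ι] [DecidableEq ι] {X : Matrix ι ι ℂ}

theorem traceNorm_eq_traceSqrt (X : Matrix ι ι ℂ) : traceNorm X = traceSqrt (X.conjTranspose * X) :=
  (traceSqrt_eq_sum (Matrix.posSemidef_conjTranspose_mul_self X)).symm

theorem traceNorm_eq_trace_abs (X : Matrix ι ι ℂ) : traceNorm X = (CFC.abs X).trace.re :=
  traceNorm_eq_traceSqrt X

open scoped Matrix.Norms.L2Operator in
theorem continuous_traceNorm : Continuous (traceNorm : Matrix ι ι ℂ → ℝ) := by
  simp_rw [funext traceNorm_eq_trace_abs]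
  exact Complex.continuous_re.comp (CFC.continuous_abs (A := Matrix ι ι ℂ)).matrix_trace

theorem traceNorm_nonneg (X : Matrix ι ι ℂ) : 0 ≤ traceNorm X :=
  Finset.sum_nonneg fun _ _ => Real.sqrt_nonneg _

theorem traceNorm_eq_trace_posPart_add_negPart (hX : X.IsHermitian) :
    traceNorm X = X⁺.trace.re + X⁻.trace.re := by
  rw [traceNorm_eq_trace_abs, ← CFC.posPart_add_negPart X hX.isSelfAdjoint, Matrix.trace_add,
    Complex.add_re]

theorem isGreatest_traceNorm (hX : X.IsHermitian) :
    IsGreatest ((fun W => (X * W).trace.re) '' Set.Icc (-1) 1) (traceNorm X) := by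
  have hcont : ∀ f : ℝ → ℝ, ContinuousOn f (spectrum ℝ X) :=
    Matrix.finite_real_spectrum.continuousOn
  let sgn : ℝ → ℝ := fun x => SignType.sign x
  have hsgn : ∀ x, -1 ≤ sgn x ∧ sgn x ≤ 1 := fun x => by
    rcases lt_trichotomy x 0 with h | rfl | h <;> simp [sgn, *]
  refine ⟨⟨cfc sgn X, ⟨?_, cfc_le_one _ _ fun x _ => (hsgn x).2⟩, ?_⟩,
    Set.forall_mem_image.mpr fun W hW => ?_⟩
  · simpa using algebraMap_le_cfc sgn (-1) X (fun x _ => (hsgn x).1) (hcont _) hX.isSelfAdjoint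
  · have hmul : X * cfc sgn X = CFC.abs X := by
      rw [CFC.abs_eq_cfc_norm X hX.isSelfAdjoint]
      nth_rewrite 1 [← cfc_id ℝ X hX.isSelfAdjoint]
      rw [← cfc_mul _ _ _ (hcont _) (hcont _)]
      exact congrArg (cfc · X) (funext self_mul_sign)
    simp only [hmul, traceNorm_eq_trace_abs]
  · have hplus := trace_mul_le_trace_mul
      (Matrix.nonneg_iff_posSemidef.mp (CFC.posPart_nonneg X)) hW.2
    have hminus := trace_mul_le_trace_mul
      (Matrix.nonneg_iff_posSemidef.mp (CFC.negPart_nonneg X)) hW.1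
    rw [mul_one] at hplus
    rw [mul_neg, mul_one, Matrix.trace_neg] at hminus
    have hre := add_le_add (Complex.le_def.mp hplus).1 (Complex.le_def.mp hminus).1
    conv_lhs => rw [← CFC.posPart_sub_negPart X hX.isSelfAdjoint, sub_mul, Matrix.trace_sub]
    rw [traceNorm_eq_trace_posPart_add_negPart hX]
    simp only [Complex.neg_re, Complex.sub_re] at hre ⊢
    linarith

theorem traceNorm_sub_le {A B : Matrix ι ι ℂ} (hA : A.PosSemidef) (hB : B.PosSemidef) :
    traceNorm (A - B) ≤ A.trace.re + B.trace.re := by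
  obtain ⟨W, hW, hmax⟩ := (isGreatest_traceNorm (hA.1.sub hB.1)).1
  have hAW := trace_mul_le_trace_mul hA hW.2
  have hBW := trace_mul_le_trace_mul hB hW.1
  rw [mul_one] at hAW
  rw [mul_neg, mul_one, Matrix.trace_neg] at hBW
  have hre := add_le_add (Complex.le_def.mp hAW).1 (Complex.le_def.mp hBW).1
  rw [← hmax]
  simp only [sub_mul, Matrix.trace_sub, Complex.sub_re, Complex.neg_re] at hre ⊢
  linarith

end TraceNorm

section PureStates

variable {ι : Type} [Fintype ι] [DecidableEq ι]

theorem traceDist_nonneg (X Y : Matrix ι ι ℂ) : 0 ≤ traceDist X Y :=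
  mul_nonneg (by norm_num) (traceNorm_nonneg _)

/- Test `ρ - σ` against the observable `2 ρ - 1`. -/
theorem one_sub_trace_mul_le_traceDist {ρ σ : QState ι} (hρ : IsIdempotentElem ρ.1) :
    1 - (ρ.1 * σ.1).trace.re ≤ traceDist ρ.1 σ.1 := by
  have hproj : IsStarProjection ρ.1 := ⟨hρ, ρ.2.1.1.isSelfAdjoint⟩
  have htrace : ((ρ.1 - σ.1) * (2 * ρ.1 - 1)).trace = 2 * (1 - (ρ.1 * σ.1).trace) := by
    rw [show (ρ.1 - σ.1) * (2 * ρ.1 - 1) = 2 • (ρ.1 * ρ.1) - ρ.1 - 2 • (σ.1 * ρ.1) + σ.1 by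
      noncomm_ring, hρ.eq, Matrix.trace_mul_comm ρ.1]
    simp only [Matrix.trace_add, Matrix.trace_sub, Matrix.trace_smul, ρ.2.2, σ.2.2]
    ring
  have hmem : 2 * ρ.1 - 1 ∈ Set.Icc (-1 : Matrix ι ι ℂ) 1 := by
    have h0 := hproj.nonneg
    have h1 := hproj.le_one
    constructor
    · rw [← sub_nonneg]; simpa [two_mul] using add_nonneg h0 h0
    · rw [two_mul, sub_le_iff_le_add]; exact add_le_add h1 h1
  have hle := (isGreatest_traceNorm (ρ.2.1.1.sub σ.2.1.1)).2 ⟨_, hmem, rfl⟩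
  simp only [htrace] at hle
  simp only [Complex.mul_re, Complex.sub_re, Complex.one_re, Complex.re_ofNat, Complex.im_ofNat,
    zero_mul, sub_zero] at hle
  rw [traceDist]
  linarith

end PureStates

section PositiveMaps

/-- Positive trace-preserving linear maps: the linear maps that send states to states, and hence do
not increase trace distances. -/
structure IsPositiveTracePreserving {ι κ : Type} [Fintype ι] [Fintype κ]
    (T : Matrix ι ι ℂ →ₗ[ℂ] Matrix κ κ ℂ) : Prop where
  posSemidef_map : ∀ {X : Matrix ι ι ℂ}, X.PosSemidef → (T X).PosSemidef
  trace_map : ∀ X : Matrix ι ι ℂ, (T X).trace = X.trace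

namespace IsPositiveTracePreserving

variable {ι κ : Type} [Fintype ι] [Fintype κ]
  {T : Matrix ι ι ℂ →ₗ[ℂ] Matrix κ κ ℂ} {X : Matrix ι ι ℂ}

theorem isHermitian_map (hT : IsPositiveTracePreserving T) (hX : X.IsHermitian) :
    (T X).IsHermitian := by
  classical
  rw [← CFC.posPart_sub_negPart X hX.isSelfAdjoint, map_sub]
  exact (hT.posSemidef_map (Matrix.nonneg_iff_posSemidef.mp (CFC.posPart_nonneg X))).1.sub
    (hT.posSemidef_map (Matrix.nonneg_iff_posSemidef.mp (CFC.negPart_nonneg X))).1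

theorem traceNorm_map_le [DecidableEq ι] [DecidableEq κ] (hT : IsPositiveTracePreserving T)
    (hX : X.IsHermitian) : traceNorm (T X) ≤ traceNorm X := by
  have hle := traceNorm_sub_le
    (hT.posSemidef_map (Matrix.nonneg_iff_posSemidef.mp (CFC.posPart_nonneg X)))
    (hT.posSemidef_map (Matrix.nonneg_iff_posSemidef.mp (CFC.negPart_nonneg X)))
  rwa [← map_sub, CFC.posPart_sub_negPart X hX.isSelfAdjoint, hT.trace_map, hT.trace_map,
    ← traceNorm_eq_trace_posPart_add_negPart hX] at hle

end IsPositiveTracePreserving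

end PositiveMaps

section TensorPowers

variable {n : ℕ} {ι κ l : Type}

theorem tensorProd_mul [Fintype κ] (A : Fin n → Matrix ι κ ℂ) (B : Fin n → Matrix κ l ℂ) :
    tensorProd A * tensorProd B = tensorProd fun k => A k * B k := by
  ext a b
  simp only [tensorProd, Matrix.mul_apply, Matrix.of_apply, ← Finset.prod_mul_distrib]
  rw [Finset.prod_univ_sum, Fintype.piFinset_univ]

theorem tensorPow_mul [Fintype κ] (A : Matrix ι κ ℂ) (B : Matrix κ l ℂ) :
    tensorPow n A * tensorPow n B = tensorPow n (A * B) :=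
  tensorProd_mul _ _

theorem tensorProd_single [DecidableEq ι] [DecidableEq κ] (i : Fin n → ι) (j : Fin n → κ) :
    tensorProd (fun k => Matrix.single (i k) (j k) (1 : ℂ)) = Matrix.single i j 1 := by
  ext a b
  simp only [tensorProd, Matrix.of_apply, Matrix.single_apply, Finset.prod_ite_zero,
    Finset.prod_const_one, Finset.mem_univ, true_imp_iff, forall_and, funext_iff]

theorem conjTranspose_tensorPow (A : Matrix ι κ ℂ) :
    (tensorPow n A).conjTranspose = tensorPow n A.conjTranspose := by
  ext a b
  simp [tensorPow, tensorProd]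

theorem posSemidef_tensorPow [Finite ι] {A : Matrix ι ι ℂ} (hA : A.PosSemidef) :
    (tensorPow n A).PosSemidef := by
  classical
  have := Fintype.ofFinite ι
  obtain ⟨B, rfl⟩ := CStarAlgebra.nonneg_iff_eq_star_mul_self.mp hA.nonneg
  rw [Matrix.star_eq_conjTranspose, ← tensorPow_mul, ← conjTranspose_tensorPow]
  exact Matrix.posSemidef_conjTranspose_mul_self _

theorem trace_tensorProd [Fintype ι] (A : Fin n → Matrix ι ι ℂ) :
    (tensorProd A).trace = ∏ k, (A k).trace := by
  simp only [Matrix.trace, tensorProd, Matrix.diag_apply, Matrix.of_apply]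
  rw [Finset.prod_univ_sum, Fintype.piFinset_univ]

theorem traceSqrt_tensorPow [Fintype ι] [DecidableEq ι] {A : Matrix ι ι ℂ} (hA : A.PosSemidef) :
    traceSqrt (tensorPow n A) = traceSqrt A ^ n := by
  have hsqrtA : (CFC.sqrt A).PosSemidef := Matrix.nonneg_iff_posSemidef.mp (CFC.sqrt_nonneg A)
  have hsqrt : CFC.sqrt (tensorPow n A) = tensorPow n (CFC.sqrt A) := by
    refine CFC.sqrt_unique ?_ (posSemidef_tensorPow hsqrtA).nonneg
    rw [tensorPow_mul, CFC.sqrt_mul_sqrt_self A hA.nonneg]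
  have hreal : (CFC.sqrt A).trace = traceSqrt A :=
    Complex.eq_re_of_ofReal_le hsqrtA.trace_nonneg
  rw [traceSqrt, hsqrt, tensorPow, trace_tensorProd, Finset.prod_const, Finset.card_univ,
    Fintype.card_fin, hreal, ← Complex.ofReal_pow, Complex.ofReal_re]

end TensorPowers

section PartialTrace

variable {ι κ : Type} [Fintype ι]

theorem partialTrace₂_sub (X Y : Matrix (κ × ι) (κ × ι) ℂ) :
    partialTrace₂ (X - Y) = partialTrace₂ X - partialTrace₂ Y := by
  ext a b
  simp [partialTrace₂]

theorem posSemidef_partialTrace₂ {X : Matrix (κ × ι) (κ × ι) ℂ} (hX : X.PosSemidef) :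
    (partialTrace₂ X).PosSemidef := by
  have hsum : partialTrace₂ X = ∑ i, X.submatrix (fun a => (a, i)) (fun a => (a, i)) := by
    ext a b
    simp [partialTrace₂, Matrix.sum_apply]
  rw [hsum]
  exact Matrix.posSemidef_sum _ fun i _ => hX.submatrix _

open scoped Kronecker

theorem partialTrace₂_kronecker_one [DecidableEq ι] (A : Matrix κ κ ℂ) :
    partialTrace₂ (A ⊗ₖ (1 : Matrix ι ι ℂ)) = (Fintype.card ι : ℂ) • A := by
  ext a b
  simp [partialTrace₂]

theorem partialTrace₂_mul_kronecker_one [DecidableEq ι] [Fintype κ]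
    (X : Matrix (κ × ι) (κ × ι) ℂ) (A : Matrix κ κ ℂ) :
    partialTrace₂ (X * A ⊗ₖ (1 : Matrix ι ι ℂ)) = partialTrace₂ X * A := by
  ext a b
  simp only [partialTrace₂, Matrix.of_apply, Matrix.mul_apply, Fintype.sum_prod_type,
    Matrix.kronecker_apply, Matrix.one_apply, mul_ite, mul_one, mul_zero, Finset.sum_ite_eq',
    Finset.mem_univ, if_true, Finset.sum_mul]
  exact Finset.sum_comm

theorem partialTrace₂_kronecker_one_mul [DecidableEq ι] [Fintype κ]
    (X : Matrix (κ × ι) (κ × ι) ℂ) (A : Matrix κ κ ℂ) :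
    partialTrace₂ (A ⊗ₖ (1 : Matrix ι ι ℂ) * X) = A * partialTrace₂ X := by
  ext a b
  simp only [partialTrace₂, Matrix.of_apply, Matrix.mul_apply, Fintype.sum_prod_type,
    Matrix.kronecker_apply, Matrix.one_apply, mul_ite, mul_one, mul_zero, ite_mul, zero_mul,
    Finset.sum_ite_eq, Finset.mem_univ, if_true, Finset.mul_sum]
  exact Finset.sum_comm

theorem partialTrace₂_mul_conjTranspose_le [Fintype κ] [Nonempty ι]
    (X : Matrix (κ × ι) (κ × ι) ℂ) :
    partialTrace₂ X * (partialTrace₂ X).conjTranspose ≤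
      (Fintype.card ι : ℂ) • partialTrace₂ (X * X.conjTranspose) := by
  classical
  have hD : (Fintype.card ι : ℂ) ≠ 0 := by exact_mod_cast Fintype.card_ne_zero
  set P := partialTrace₂ X
  set Q := (Fintype.card ι : ℂ)⁻¹ • P
  have hPQ : (Fintype.card ι : ℂ) • Q = P := smul_inv_smul₀ hD P
  -- `X - Q ⊗ 1` has partial trace zero, so its second moment is a variance.
  set Y := X - Q ⊗ₖ (1 : Matrix ι ι ℂ)
  have hP : partialTrace₂ X.conjTranspose = P.conjTranspose := by
    ext a b
    simp only [P, partialTrace₂, Matrix.conjTranspose_apply, Matrix.of_apply, star_sum]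
  have hvar : partialTrace₂ (Y * Y.conjTranspose) =
      partialTrace₂ (X * X.conjTranspose) - Q * P.conjTranspose := by
    rw [Matrix.conjTranspose_sub, Matrix.conjTranspose_kronecker, Matrix.conjTranspose_one, sub_mul,
      mul_sub, mul_sub, ← Matrix.mul_kronecker_mul, one_mul]
    simp only [partialTrace₂_sub, partialTrace₂_mul_kronecker_one, partialTrace₂_kronecker_one_mul,
      partialTrace₂_kronecker_one, hP, ← Matrix.smul_mul, hPQ]
    abel
  have hY : (partialTrace₂ (Y * Y.conjTranspose)).PosSemidef :=
    posSemidef_partialTrace₂ (Matrix.posSemidef_self_mul_conjTranspose Y)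
  have hDY := hY.smul (Nat.cast_nonneg (α := ℂ) (Fintype.card ι))
  rwa [hvar, smul_sub, ← Matrix.smul_mul, hPQ] at hDY

end PartialTrace

section ChoiState

variable {ι κ : Type} [Fintype ι] [DecidableEq ι] (T : Matrix ι ι ℂ →ₗ[ℂ] Matrix κ κ ℂ)

theorem map_eq_sum_single (X : Matrix ι ι ℂ) :
    T X = ∑ i, ∑ j, X i j • T (Matrix.single i j 1) := by
  conv_lhs => rw [Matrix.matrix_eq_sum_single X]
  simp only [map_sum, ← map_smul, Matrix.smul_single, smul_eq_mul, mul_one]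

theorem choiState_apply (a b : κ) (i j : ι) :
    choiState T (a, i) (b, j) = (Fintype.card ι : ℂ)⁻¹ * T (Matrix.single i j 1) a b := by
  have hnorm : ((1 / √(Fintype.card ι : ℝ) : ℝ) : ℂ) * ((1 / √(Fintype.card ι : ℝ) : ℝ) : ℂ) =
      (Fintype.card ι : ℂ)⁻¹ := by
    rw [← Complex.ofReal_mul, div_mul_div_comm, Real.mul_self_sqrt (Nat.cast_nonneg _), one_mul,
      one_div, Complex.ofReal_inv, Complex.ofReal_natCast]
  have hblock : (Matrix.of fun k l => Matrix.vecMulVec (maxEntangled ι) (star (maxEntangled ι))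
      (k, i) (l, j)) = (Fintype.card ι : ℂ)⁻¹ • Matrix.single i j (1 : ℂ) := by
    rw [← hnorm]
    ext k l
    simp only [Matrix.vecMulVec, Matrix.of_apply, maxEntangled, Pi.star_apply, Matrix.smul_apply,
      Matrix.single_apply, smul_eq_mul, apply_ite star, star_zero, RCLike.star_def,
      Complex.conj_ofReal, eq_comm (a := i), eq_comm (a := j)]
    by_cases hk : k = i <;> by_cases hl : l = j <;> simp [hk, hl]
  rw [choiState, ampliation, Matrix.of_apply, hblock, map_smul, Matrix.smul_apply, smul_eq_mul]

theorem partialTrace₂_choiState : partialTrace₂ (choiState T) = averageOutput T := by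
  ext a b
  rw [averageOutput, map_smul, ← Matrix.sum_single_one, map_sum]
  simp only [partialTrace₂, Matrix.of_apply, choiState_apply, Matrix.smul_apply, Matrix.sum_apply,
    smul_eq_mul, Finset.mul_sum]

theorem partialTrace₂_choiState_sq [Fintype κ] [DecidableEq κ] :
    partialTrace₂ (choiState T ^ 2) = ((Fintype.card ι : ℂ)⁻¹ ^ 2) •
      ∑ i, ∑ j, T (Matrix.single i j 1) * T (Matrix.single j i 1) := by
  ext a b
  simp only [partialTrace₂, Matrix.of_apply, pow_two (choiState T), Matrix.mul_apply,
    Fintype.sum_prod_type, choiState_apply, Matrix.smul_apply, Matrix.sum_apply, smul_eq_mul,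
    Finset.mul_sum]
  refine Finset.sum_congr rfl fun i _ => ?_
  rw [Finset.sum_comm]
  refine Finset.sum_congr rfl fun j _ => Finset.sum_congr rfl fun c _ => ?_
  ring

variable {T}

open scoped Matrix in
theorem posSemidef_map_of_choiState [Finite κ] (hT : (choiState T).PosSemidef) {X : Matrix ι ι ℂ}
    (hX : X.PosSemidef) : (T X).PosSemidef := by
  classical
  have := Fintype.ofFinite κ
  cases isEmpty_or_nonempty ι
  · rw [Subsingleton.elim X 0, map_zero]
    exact Matrix.PosSemidef.zero
  have hD : (Fintype.card ι : ℂ) ≠ 0 := by exact_mod_cast Fintype.card_ne_zero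
  set S : Matrix (κ × ι) (κ × ι) ℂ := X.submatrix Prod.snd Prod.snd ⊙ choiState T
  set V : Matrix κ (κ × ι) ℂ := (1 : Matrix κ κ ℂ).submatrix id Prod.fst
  have hTX : T X = (Fintype.card ι : ℂ) • (V * S * V.conjTranspose) := by
    ext a b
    rw [map_eq_sum_single T X]
    simp only [Matrix.sum_apply, Matrix.smul_apply, smul_eq_mul, Matrix.mul_apply, V, S,
      Matrix.conjTranspose_submatrix, Matrix.conjTranspose_one, Matrix.submatrix_apply, id,
      Matrix.one_apply, Fintype.sum_prod_type, Matrix.hadamard_apply, choiState_apply, ite_mul,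
      one_mul, zero_mul, mul_ite, mul_one, mul_zero, Finset.sum_ite_irrel, Finset.sum_const_zero,
      Finset.sum_ite_eq, Finset.sum_ite_eq', Finset.mem_univ, if_true, Finset.mul_sum]
    rw [Finset.sum_comm]
    refine Finset.sum_congr rfl fun j _ => Finset.sum_congr rfl fun i _ => ?_
    field_simp
  rw [hTX]
  exact (((hX.submatrix _).hadamard hT).mul_mul_conjTranspose_same V).smul (Nat.cast_nonneg _)

theorem IsCompletelyPositive.posSemidef_choiState (hT : IsCompletelyPositive T) :
    (choiState T).PosSemidef := by
  have hmax := Matrix.posSemidef_vecMulVec_self_star (maxEntangled ι)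
  have hfin := hT _ _ (hmax.submatrix (Prod.map id (Fintype.equivFin ι).symm))
  convert hfin.submatrix (Prod.map id (Fintype.equivFin ι))
  ext p q
  simp [choiState, ampliation, Matrix.submatrix]

end ChoiState

section ChannelPow

variable {n : ℕ} {ι κ : Type} [Fintype ι] [DecidableEq ι] (Φ : Matrix ι ι ℂ →ₗ[ℂ] Matrix κ κ ℂ)

theorem channelPow_single (i j : Fin n → ι) :
    channelPow n Φ (Matrix.single i j 1) = tensorProd fun k => Φ (Matrix.single (i k) (j k) 1) := by
  rw [← tensorProd_single, channelPow_tensorProd]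

theorem averageOutput_channelPow :
    averageOutput (channelPow n Φ) = tensorPow n (averageOutput Φ) := by
  rw [averageOutput, averageOutput, tensorPow, ← channelPow_tensorProd]
  congr 1
  ext a b
  simp only [tensorProd, Matrix.smul_apply, Matrix.of_apply, Matrix.one_apply, smul_eq_mul,
    Finset.prod_mul_distrib, Finset.prod_const, Finset.card_univ, Fintype.card_fin,
    Fintype.card_pi, Nat.cast_pow, inv_pow, Finset.prod_ite_zero, Finset.mem_univ, true_imp_iff,
    one_pow, funext_iff]

theorem choiState_channelPow :
    choiState (channelPow n Φ) = (tensorPow n (choiState Φ)).submatrix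
      (fun p k => (p.1 k, p.2 k)) (fun p k => (p.1 k, p.2 k)) := by
  ext ⟨a, i⟩ ⟨b, j⟩
  simp only [choiState_apply, channelPow_single, tensorPow, tensorProd, Matrix.submatrix_apply,
    Matrix.of_apply, Finset.prod_mul_distrib, Finset.prod_const, Finset.card_univ,
    Fintype.card_fin, Fintype.card_pi, Nat.cast_pow, inv_pow]

theorem partialTrace₂_choiState_channelPow_sq [Fintype κ] [DecidableEq κ] :
    partialTrace₂ (choiState (channelPow n Φ) ^ 2) =
      tensorPow n (partialTrace₂ (choiState Φ ^ 2)) := by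
  have hsq : choiState (channelPow n Φ) ^ 2 = (tensorPow n (choiState Φ ^ 2)).submatrix
      (fun p k => (p.1 k, p.2 k)) (fun p k => (p.1 k, p.2 k)) := by
    rw [choiState_channelPow, pow_two, pow_two, ← tensorPow_mul]
    exact Matrix.submatrix_mul_equiv _ _ _
      (Equiv.arrowProdEquivProdArrow (Fin n) (fun _ => κ) (fun _ => ι)).symm _
  ext a b
  rw [hsq]
  simp only [partialTrace₂, tensorPow, tensorProd, Matrix.of_apply, Matrix.submatrix_apply]
  rw [Finset.prod_univ_sum, Fintype.piFinset_univ]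

variable {Φ}

theorem trace_channelPow [Fintype κ] (hΦ : ∀ X, (Φ X).trace = X.trace)
    (X : Matrix (Fin n → ι) (Fin n → ι) ℂ) : (channelPow n Φ X).trace = X.trace := by
  have hsingle (i j : Fin n → ι) : (channelPow n Φ (Matrix.single i j 1)).trace =
      (Matrix.single i j (1 : ℂ)).trace := by
    rw [channelPow_single, trace_tensorProd, ← tensorProd_single, trace_tensorProd]
    simp only [hΦ]
  rw [map_eq_sum_single (channelPow n Φ) X]
  conv_rhs => rw [← LinearMap.id_apply (R := ℂ) X, map_eq_sum_single LinearMap.id X]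
  simp only [Matrix.trace_sum, Matrix.trace_smul, hsingle, LinearMap.id_apply]

theorem IsCompletelyPositive.posSemidef_choiState_channelPow [Finite κ]
    (hΦ : IsCompletelyPositive Φ) (n : ℕ) : (choiState (channelPow n Φ)).PosSemidef := by
  have := Fintype.ofFinite κ
  rw [choiState_channelPow]
  exact (posSemidef_tensorPow hΦ.posSemidef_choiState).submatrix _

theorem IsQuantumChannel.isPositiveTracePreserving_channelPow [Fintype κ]
    (hΦ : IsQuantumChannel Φ) (n : ℕ) : IsPositiveTracePreserving (channelPow n Φ) where
  posSemidef_map :=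
    posSemidef_map_of_choiState (hΦ.completelyPositive.posSemidef_choiState_channelPow n)
  trace_map := trace_channelPow hΦ.tracePreserving

end ChannelPow

section SecondMoment

variable {ι κ : Type} [Fintype ι] [DecidableEq ι] [Fintype κ] [DecidableEq κ]
  {T : Matrix ι ι ℂ →ₗ[ℂ] Matrix κ κ ℂ}

/-- The expectation of `T (ρ - σ) ^ 2` for independent pure states `ρ` and `σ`, each drawn from a
projective 2-design (`integral_map_sub_sq`). -/
noncomputable def secondMoment (T : Matrix ι ι ℂ →ₗ[ℂ] Matrix κ κ ℂ) : Matrix κ κ ℂ :=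
  (2 / ((Fintype.card ι : ℂ) + 1)) •
    ((Fintype.card ι : ℂ) • partialTrace₂ (choiState T ^ 2) - averageOutput T ^ 2)

theorem averageOutput_sq_le [Nonempty ι] (hT : (choiState T).PosSemidef) :
    averageOutput T ^ 2 ≤ (Fintype.card ι : ℂ) • partialTrace₂ (choiState T ^ 2) := by
  have h := partialTrace₂_mul_conjTranspose_le (choiState T)
  have hpi := (posSemidef_partialTrace₂ hT).isHermitian.eq
  rwa [hpi, hT.isHermitian.eq, partialTrace₂_choiState, ← pow_two, ← pow_two] at h

theorem secondMoment_posSemidef [Nonempty ι] (hT : (choiState T).PosSemidef) :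
    (secondMoment T).PosSemidef := by
  refine (Matrix.le_iff.mp (averageOutput_sq_le hT)).smul ?_
  positivity

theorem secondMoment_le (hT : (choiState T).PosSemidef) :
    secondMoment T ≤ (2 : ℝ) • partialTrace₂ (choiState T ^ 2) := by
  have hD : ((Fintype.card ι : ℂ) + 1) ≠ 0 := by exact_mod_cast (Fintype.card ι).succ_ne_zero
  have htau : (partialTrace₂ (choiState T ^ 2)).PosSemidef := posSemidef_partialTrace₂ (hT.pow 2)
  have hpi : (averageOutput T ^ 2).PosSemidef := by
    rw [← partialTrace₂_choiState]
    exact (posSemidef_partialTrace₂ hT).pow 2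
  have hsub : (2 : ℝ) • partialTrace₂ (choiState T ^ 2) - secondMoment T =
      (2 / ((Fintype.card ι : ℂ) + 1)) •
        (partialTrace₂ (choiState T ^ 2) + averageOutput T ^ 2) := by
    ext a b
    simp only [secondMoment, Matrix.sub_apply, Matrix.add_apply, Matrix.smul_apply, smul_eq_mul,
      Complex.real_smul, Complex.ofReal_ofNat]
    field_simp
    ring
  rw [Matrix.le_iff, hsub]
  refine (htau.add hpi).smul ?_
  positivity

theorem secondMoment_channelPow (n : ℕ) (Φ : Matrix ι ι ℂ →ₗ[ℂ] Matrix κ κ ℂ) :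
    secondMoment (channelPow n Φ) = (2 / ((Fintype.card ι : ℂ) ^ n + 1)) •
      ((Fintype.card ι : ℂ) ^ n • tensorPow n (partialTrace₂ (choiState Φ ^ 2)) -
        tensorPow n (averageOutput Φ ^ 2)) := by
  rw [secondMoment, partialTrace₂_choiState_channelPow_sq, averageOutput_channelPow,
    pow_two (tensorPow n _), tensorPow_mul, ← pow_two, Fintype.card_pi, Finset.prod_const,
    Finset.card_univ, Fintype.card_fin, Nat.cast_pow]

end SecondMoment

section UnitaryTwirl

open scoped Kronecker

variable {ι : Type} [Fintype ι] [DecidableEq ι]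

theorem smul_one_add_smul_swap_mem_unitaryGroup (a b : ι) :
    ((1 + Complex.I) / 2) • (1 : Matrix ι ι ℂ) +
      ((1 - Complex.I) / 2) • Equiv.Perm.permMatrix ℂ (Equiv.swap a b) ∈
        Matrix.unitaryGroup ι ℂ := by
  set S := Equiv.Perm.permMatrix ℂ (Equiv.swap a b)
  have hS : star S = S := by
    rw [Matrix.star_eq_conjTranspose, Matrix.conjTranspose_permMatrix, Equiv.swap_inv]
  have hSS : S * S = 1 := by
    rw [← Matrix.permMatrix_mul, Equiv.swap_mul_self, Matrix.permMatrix_one]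
  rw [Matrix.mem_unitaryGroup_iff, star_add, star_smul, star_smul, star_one, hS, add_mul,
    mul_add, mul_add]
  simp only [Matrix.smul_mul, Matrix.mul_smul, one_mul, mul_one, hSS, smul_smul]
  have hI : star ((1 + Complex.I) / 2) = (1 - Complex.I) / 2 := by
    simp [sub_eq_add_neg]
  have hI' : star ((1 - Complex.I) / 2) = (1 + Complex.I) / 2 := by
    simp
  rw [hI, hI']
  match_scalars
  · linear_combination (-1 / 2) * Complex.I_mul_I
  · linear_combination (1 / 2) * Complex.I_mul_I

variable {M : Matrix (ι × ι) (ι × ι) ℂ}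

theorem apply_eq_zero_of_commute_kronecker_self
    (hcomm : ∀ V ∈ Matrix.unitaryGroup ι ℂ, Commute (V ⊗ₖ V) M) {i k j l : ι}
    (hne : ¬(i = j ∧ k = l)) (hne' : ¬(i = l ∧ k = j)) : M (i, k) (j, l) = 0 := by
  have hphase (m : ι) : (if i = m then Complex.I else 1) * (if k = m then Complex.I else 1) *
      M (i, k) (j, l) =
      (if j = m then Complex.I else 1) * (if l = m then Complex.I else 1) * M (i, k) (j, l) := by
    have hV : Matrix.diagonal (fun x => if x = m then Complex.I else 1) ∈
        Matrix.unitaryGroup ι ℂ := by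
      rw [Matrix.mem_unitaryGroup_iff, Matrix.star_eq_conjTranspose, Matrix.diagonal_conjTranspose,
        Matrix.diagonal_mul_diagonal, ← Matrix.diagonal_one]
      congr 1
      ext x
      by_cases hx : x = m <;> simp [hx]
    have h := congrFun₂ (hcomm _ hV).eq (i, k) (j, l)
    rwa [Matrix.diagonal_kronecker_diagonal, Matrix.diagonal_mul, Matrix.mul_diagonal,
      mul_comm (M _ _)] at h
  by_contra hM
  have hi := mul_right_cancel₀ hM (hphase i)
  have hk := mul_right_cancel₀ hM (hphase k)
  have hI : Complex.I * Complex.I ≠ Complex.I ∧ Complex.I * Complex.I ≠ 1 ∧ Complex.I ≠ 1 := by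
    norm_num [Complex.ext_iff]
  grind

theorem apply_diag_of_commute_kronecker_self
    (hcomm : ∀ V ∈ Matrix.unitaryGroup ι ℂ, Commute (V ⊗ₖ V) M)
    (hsymm : ∀ i k j l, M (i, k) (j, l) = M (i, k) (l, j)) {a b c : ι} (hab : a ≠ b)
    (hc : c = a ∨ c = b) : M (c, c) (c, c) = 2 * M (a, b) (a, b) := by
  set V := ((1 + Complex.I) / 2) • (1 : Matrix ι ι ℂ) +
      ((1 - Complex.I) / 2) • Equiv.Perm.permMatrix ℂ (Equiv.swap a b)
  have hV := hcomm V (smul_one_add_smul_swap_mem_unitaryGroup a b)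
  have hVc : V a c * V b c = 1 / 2 := by
    rcases hc with rfl | rfl <;> simp [V, hab, hab.symm] <;>
      linear_combination (-1 / 4) * Complex.I_mul_I
  have hleft : (V ⊗ₖ V * M) (a, b) (c, c) = 1 / 2 * M (c, c) (c, c) := by
    rw [Matrix.mul_apply, Fintype.sum_eq_single (c, c), Matrix.kronecker_apply,
      hVc]
    rintro ⟨x, y⟩ hxy
    rw [apply_eq_zero_of_commute_kronecker_self hcomm, mul_zero] <;> simp_all
  have hright : (M * V ⊗ₖ V) (a, b) (c, c) = M (a, b) (a, b) := by
    rw [Matrix.mul_apply, Fintype.sum_eq_add (a, b) (b, a) (by simp [hab]),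
      Matrix.kronecker_apply, Matrix.kronecker_apply, hsymm a b b a]
    · linear_combination 2 * M (a, b) (a, b) * hVc
    rintro ⟨x, y⟩ hxy
    rw [apply_eq_zero_of_commute_kronecker_self hcomm, zero_mul] <;> grind
  have hentry := congrFun₂ hV.eq (a, b) (c, c)
  rw [hleft, hright] at hentry
  linear_combination 2 * hentry

theorem apply_eq_of_commute_kronecker_self
    (hcomm : ∀ V ∈ Matrix.unitaryGroup ι ℂ, Commute (V ⊗ₖ V) M)
    (hsymm : ∀ i k j l, M (i, k) (j, l) = M (i, k) (l, j)) (i k j l : ι) :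
    M (i, k) (j, l) = ((if i = j ∧ k = l then 1 else 0) + if i = l ∧ k = j then 1 else 0) /
      ((Fintype.card ι : ℂ) * (Fintype.card ι + 1)) * M.trace := by
  have hD : (Fintype.card ι : ℂ) ≠ 0 := by exact_mod_cast (Fintype.card_pos_iff.mpr ⟨i⟩).ne'
  have hD' : (Fintype.card ι : ℂ) + 1 ≠ 0 := by exact_mod_cast (Fintype.card ι).succ_ne_zero
  obtain ⟨c, hc⟩ : ∃ c, ∀ a, M (a, a) (a, a) = c := by
    refine ⟨M (i, i) (i, i), fun a => ?_⟩
    rcases eq_or_ne a i with rfl | ha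
    · rfl
    rw [apply_diag_of_commute_kronecker_self hcomm hsymm ha (.inl rfl),
      apply_diag_of_commute_kronecker_self hcomm hsymm ha (.inr rfl)]
  have hdiag (a b : ι) :
      M (a, b) (a, b) = c / 2 * (1 + if a = b then 1 else 0) := by
    rw [← hc a]
    rcases eq_or_ne a b with rfl | hab
    · rw [if_pos rfl]
      ring
    · rw [if_neg hab, apply_diag_of_commute_kronecker_self hcomm hsymm hab (.inl rfl)]
      ring
  have htrace : M.trace = c / 2 * (Fintype.card ι * (Fintype.card ι + 1)) := by
    simp only [Matrix.trace, Matrix.diag_apply, Fintype.sum_prod_type, hdiag, ← Finset.mul_sum,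
      Finset.sum_add_distrib, Finset.sum_const, Finset.card_univ, Finset.sum_ite_eq,
      Finset.mem_univ, if_true, nsmul_eq_mul, Fintype.card_prod, Nat.cast_mul]
    ring
  have hentry : M (i, k) (j, l) = c / 2 *
      ((if i = j ∧ k = l then 1 else 0) + if i = l ∧ k = j then 1 else 0) := by
    by_cases hne : i = j ∧ k = l
    · rw [← hne.1, ← hne.2, hdiag]
      grind
    by_cases hne' : i = l ∧ k = j
    · rw [← hne'.1, ← hne'.2, hsymm, hdiag]
      grind
    rw [apply_eq_zero_of_commute_kronecker_self hcomm hne hne', if_neg hne, if_neg hne', add_zero,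
      mul_zero]
  rw [htrace, hentry]
  field_simp

end UnitaryTwirl

theorem isIdempotentElem_vecMulVec {ι : Type*} [Fintype ι] {v w : ι → ℂ}
    (h : (Matrix.vecMulVec v w).trace = 1) :
    IsIdempotentElem (Matrix.vecMulVec v w) := by
  rw [IsIdempotentElem, Matrix.vecMulVec_mul_vecMulVec]
  rw [Matrix.trace_vecMulVec, dotProduct_comm] at h
  rw [h, one_smul]

open scoped Matrix.Norms.L2Operator in
theorem integral_matrix_apply {m Ω : Type*} [Fintype m] [DecidableEq m] [MeasurableSpace Ω]
    {μ : Measure Ω} {f : Ω → Matrix m m ℂ} (hf : Integrable f μ) (i j : m) :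
    (∫ ω, f ω ∂μ) i j = ∫ ω, f ω i j ∂μ :=
  ((Matrix.entryLinearMap ℂ ℂ i j).toContinuousLinearMap.integral_comp_comm hf).symm

section Haar

variable {ι : Type} [Fintype ι] [DecidableEq ι]

instance : IsProbabilityMeasure (haarUnitary ι) :=
  ⟨Measure.haarMeasure_self (K₀ := (⊤ : TopologicalSpace.PositiveCompacts _))⟩

instance : Measure.IsMulLeftInvariant (haarUnitary ι) :=
  inferInstanceAs (Measure.IsMulLeftInvariant (Measure.haarMeasure ⊤))

theorem conjState_mul (V U : Matrix.unitaryGroup ι ℂ) (ρ : QState ι) :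
    (conjState (V * U) ρ).1 = V * (conjState U ρ).1 * star (V : Matrix ι ι ℂ) := by
  simp only [conjState, Matrix.UnitaryGroup.mul_val, star_mul, mul_assoc]

open scoped Kronecker Matrix.Norms.L2Operator in
theorem integrable_conjState_kronecker_self (ρ : QState ι) :
    Integrable (fun U => (conjState U ρ).1 ⊗ₖ (conjState U ρ).1) (haarUnitary ι) := by
  refine Continuous.integrable_of_hasCompactSupport ?_ (HasCompactSupport.of_compactSpace _)
  refine continuous_matrix fun p q => ?_
  simp only [Matrix.kroneckerMap_apply, conjState]
  fun_prop

open scoped Kronecker Matrix.Norms.L2Operator in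
theorem commute_kronecker_self_integral_conjState (ρ : QState ι) {V : Matrix ι ι ℂ}
    (hV : V ∈ Matrix.unitaryGroup ι ℂ) :
    Commute (V ⊗ₖ V) (∫ U, (conjState U ρ).1 ⊗ₖ (conjState U ρ).1 ∂(haarUnitary ι)) := by
  set K : Matrix.unitaryGroup ι ℂ → Matrix (ι × ι) (ι × ι) ℂ :=
    fun U => (conjState U ρ).1 ⊗ₖ (conjState U ρ).1
  have hint : Integrable K (haarUnitary ι) := integrable_conjState_kronecker_self ρ
  have hshift (U) : (V ⊗ₖ V) * K U = K (⟨V, hV⟩ * U) * (V ⊗ₖ V) := by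
    simp only [K, conjState_mul, ← Matrix.mul_kronecker_mul, mul_assoc,
      (Matrix.mem_unitaryGroup_iff'.mp hV), mul_one]
  calc (V ⊗ₖ V) * ∫ U, K U ∂(haarUnitary ι)
      = ∫ U, K (⟨V, hV⟩ * U) * (V ⊗ₖ V) ∂(haarUnitary ι) := by
        rw [← integral_const_mul_of_integrable hint]
        simp only [hshift]
    _ = (∫ U, K (⟨V, hV⟩ * U) ∂(haarUnitary ι)) * (V ⊗ₖ V) :=
        integral_mul_const_of_integrable (hint.comp_mul_left _)
    _ = (∫ U, K U ∂(haarUnitary ι)) * (V ⊗ₖ V) := by rw [integral_mul_left_eq_self]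

theorem conjState_pureState (U : Matrix.unitaryGroup ι ℂ) (φ : EuclideanSpace ℂ ι)
    (hφ : ‖φ‖ = 1) : (conjState U (pureState φ hφ)).1 =
      Matrix.vecMulVec ((U : Matrix ι ι ℂ).mulVec φ) (star ((U : Matrix ι ι ℂ).mulVec φ)) := by
  simp only [conjState, pureState, Matrix.mul_vecMulVec, Matrix.vecMulVec_mul, Matrix.star_mulVec,
    Matrix.star_eq_conjTranspose]

open scoped Kronecker Matrix.Norms.L2Operator in
theorem integral_haarUnitary_conjState_mul {φ : EuclideanSpace ℂ ι} (hφ : ‖φ‖ = 1)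
    (i j k l : ι) :
    ∫ U, (conjState U (pureState φ hφ)).1 i j * (conjState U (pureState φ hφ)).1 k l
        ∂(haarUnitary ι) =
      ((if i = j ∧ k = l then 1 else 0) + if i = l ∧ k = j then 1 else 0) /
        ((Fintype.card ι : ℂ) * (Fintype.card ι + 1)) := by
  set K : Matrix.unitaryGroup ι ℂ → Matrix (ι × ι) (ι × ι) ℂ :=
    fun U => (conjState U (pureState φ hφ)).1 ⊗ₖ (conjState U (pureState φ hφ)).1
  have hint : Integrable K (haarUnitary ι) := integrable_conjState_kronecker_self _
  have hsymm (i k j l : ι) : (∫ U, K U ∂(haarUnitary ι)) (i, k) (j, l) =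
      (∫ U, K U ∂(haarUnitary ι)) (i, k) (l, j) := by
    rw [integral_matrix_apply hint, integral_matrix_apply hint]
    congr 1
    ext U
    simp only [K, conjState_pureState, Matrix.kroneckerMap_apply, Matrix.vecMulVec_apply]
    ring
  have htrace : (∫ U, K U ∂(haarUnitary ι)).trace = 1 := by
    have hK (U) : (K U).trace = 1 := by
      rw [Matrix.trace_kronecker, (conjState U (pureState φ hφ)).2.2, one_mul]
    have hcomm :=
      (Matrix.traceLinearMap (ι × ι) ℂ ℂ).toContinuousLinearMap.integral_comp_comm hint
    simp only [LinearMap.coe_toContinuousLinearMap', Matrix.traceLinearMap_apply, hK,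
      integral_const, probReal_univ, one_smul] at hcomm
    exact hcomm.symm
  have h := apply_eq_of_commute_kronecker_self
    (fun _ => commute_kronecker_self_integral_conjState (pureState φ hφ)) hsymm i k j l
  rwa [htrace, mul_one, integral_matrix_apply hint] at h

end Haar

section Bidegree

variable {ι : Type} [Fintype ι]

theorem HasBidegreeLE.mul {s t : ℕ} {P Q : MvPolynomial ((ι × ι) ⊕ (ι × ι)) ℂ}
    (hP : HasBidegreeLE s P) (hQ : HasBidegreeLE t Q) : HasBidegreeLE (s + t) (P * Q) := by
  classical
  intro m hm
  obtain ⟨x, hx, y, hy, rfl⟩ := Finset.mem_add.mp (MvPolynomial.support_mul P Q hm)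
  simp only [Finsupp.add_apply, Finset.sum_add_distrib]
  exact ⟨add_le_add (hP x hx).1 (hQ y hy).1, add_le_add (hP x hx).2 (hQ y hy).2⟩

theorem HasBidegreeLE.sum {α : Type*} {t : ℕ} (A : Finset α)
    {P : α → MvPolynomial ((ι × ι) ⊕ (ι × ι)) ℂ} (hP : ∀ a ∈ A, HasBidegreeLE t (P a)) :
    HasBidegreeLE t (∑ a ∈ A, P a) := by
  classical
  intro m hm
  obtain ⟨a, ha, hma⟩ := Finset.mem_biUnion.mp (MvPolynomial.support_sum hm)
  exact hP a ha m hma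

/-- The polynomial in the entries of `U` and `U†` whose value is the `(i, j)` entry of `U A U†`. -/
noncomputable def conjPoly (A : Matrix ι ι ℂ) (i j : ι) : MvPolynomial ((ι × ι) ⊕ (ι × ι)) ℂ :=
  ∑ a, ∑ b, MvPolynomial.monomial
    (Finsupp.single (Sum.inl (i, a)) 1 + Finsupp.single (Sum.inr (b, j)) 1) (A a b)

theorem hasBidegreeLE_conjPoly (A : Matrix ι ι ℂ) (i j : ι) : HasBidegreeLE 1 (conjPoly A i j) := by
  classical
  refine .sum _ fun a _ => .sum _ fun b _ m hm => ?_
  obtain rfl := Finset.mem_singleton.mp (MvPolynomial.support_monomial_subset hm)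
  simp [Finsupp.single_apply]

theorem evalUnitary_conjPoly [DecidableEq ι] (ρ : QState ι) (i j : ι)
    (U : Matrix.unitaryGroup ι ℂ) : evalUnitary (conjPoly ρ.1 i j) U = (conjState U ρ).1 i j := by
  simp only [evalUnitary, conjPoly, conjState, map_sum, Matrix.mul_apply, Finset.sum_mul]
  rw [Finset.sum_comm]
  refine Finset.sum_congr rfl fun b _ => Finset.sum_congr rfl fun a _ => ?_
  simp [MvPolynomial.eval_monomial, Finsupp.prod_add_index', pow_add]
  ring

end Bidegree

section ProjectiveDesign

variable {ι : Type} [Fintype ι] [DecidableEq ι]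

theorem IsUnitaryDesign.integral_conjState_mul {μ : Measure (Matrix.unitaryGroup ι ℂ)}
    (hμ : IsUnitaryDesign 2 μ) (ρ : QState ι) (i j k l : ι) :
    ∫ U, (conjState U ρ).1 i j * (conjState U ρ).1 k l ∂μ =
      ∫ U, (conjState U ρ).1 i j * (conjState U ρ).1 k l ∂(haarUnitary ι) := by
  have hmul (U : Matrix.unitaryGroup ι ℂ) : (conjState U ρ).1 i j * (conjState U ρ).1 k l =
      evalUnitary (conjPoly ρ.1 i j * conjPoly ρ.1 k l) U := by
    rw [← evalUnitary_conjPoly, ← evalUnitary_conjPoly, evalUnitary, evalUnitary, evalUnitary,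
      map_mul]
  simp only [hmul]
  exact hμ.average _ ((hasBidegreeLE_conjPoly _ _ _).mul (hasBidegreeLE_conjPoly _ _ _))

/-- Projective 2-designs: probability distributions on the pure states whose second moments are
those of the unitarily invariant distribution, `E[ρ ⊗ ρ] = (1 + F) / (D (D + 1))` with `F` the flip
operator. Purity is encoded by idempotence. -/
structure IsProjectiveTwoDesign (ν : Measure (QState ι)) : Prop where
  isProbabilityMeasure : IsProbabilityMeasure ν
  ae_isIdempotentElem : ∀ᵐ ρ ∂ν, IsIdempotentElem ρ.1
  integral_mul : ∀ i j k l, ∫ ρ, ρ.1 i j * ρ.1 k l ∂ν =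
    ((if i = j ∧ k = l then 1 else 0) + if i = l ∧ k = j then 1 else 0) /
      ((Fintype.card ι : ℂ) * (Fintype.card ι + 1))

theorem IsStateDesign.isProjectiveTwoDesign {ν : Measure (QState ι)} (hν : IsStateDesign 2 ν) :
    IsProjectiveTwoDesign ν := by
  obtain ⟨φ, hφ, μ, hμ, rfl⟩ := hν
  have := hμ.isProbabilityMeasure
  have hmeas := (measurable_conjState (pureState φ hφ)).aemeasurable (μ := μ)
  refine ⟨Measure.isProbabilityMeasure_map hmeas, ?_, fun i j k l => ?_⟩
  · refine (ae_map_iff hmeas ?_).mpr (.of_forall fun U => ?_)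
    · exact (isClosed_eq (continuous_subtype_val.mul continuous_subtype_val)
        continuous_subtype_val).measurableSet
    · have htrace := (conjState U (pureState φ hφ)).2.2
      rw [conjState_pureState] at htrace ⊢
      exact isIdempotentElem_vecMulVec htrace
  · rw [integral_map hmeas, hμ.integral_conjState_mul, integral_haarUnitary_conjState_mul]
    exact ((continuous_subtype_val.matrix_elem i j).mul
      (continuous_subtype_val.matrix_elem k l)).aestronglyMeasurable

end ProjectiveDesign

section StateSpace

theorem integrable_of_continuous {X E : Type*} [TopologicalSpace X] [CompactSpace X]
    [MeasurableSpace X] [OpensMeasurableSpace X] [NormedAddCommGroup E] {μ : Measure X}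
    [IsFiniteMeasure μ] {f : X → E} (hf : Continuous f) : Integrable f μ :=
  hf.integrable_of_hasCompactSupport (.of_compactSpace f)

variable {ι : Type} [Fintype ι]

theorem QState.le_one [DecidableEq ι] (ρ : QState ι) : ρ.1 ≤ 1 := by
  rw [← map_one (algebraMap ℝ (Matrix ι ι ℂ))]
  refine le_algebraMap_of_spectrum_le (fun x hx => ?_) ρ.2.1.1.isSelfAdjoint
  rw [ρ.2.1.1.spectrum_real_eq_range_eigenvalues] at hx
  obtain ⟨i, rfl⟩ := hx
  have hsum : ∑ j, ρ.2.1.1.eigenvalues j = 1 := by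
    have htrace := ρ.2.1.1.trace_eq_sum_eigenvalues.symm.trans ρ.2.2
    exact RCLike.ofReal_injective (K := ℂ) (by push_cast; exact htrace)
  exact (Finset.single_le_sum (fun j _ => ρ.2.1.eigenvalues_nonneg j)
    (Finset.mem_univ i)).trans_eq hsum

open scoped Matrix.Norms.L2Operator in
instance : CompactSpace (QState ι) := by
  classical
  refine isCompact_iff_compactSpace.mp (Metric.isCompact_of_isClosed_isBounded ?_ ?_)
  · have hnonneg : IsClosed {ρ : Matrix ι ι ℂ | ρ.PosSemidef} := by
      simp_rw [← Matrix.nonneg_iff_posSemidef]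
      exact CStarAlgebra.isClosed_nonneg
    exact hnonneg.inter (isClosed_eq continuous_id.matrix_trace continuous_const)
  · refine (Metric.isBounded_closedBall (x := (0 : Matrix ι ι ℂ)) (r := 1)).subset fun ρ hρ => ?_
    rw [mem_closedBall_zero_iff]
    exact (CStarAlgebra.norm_le_one_iff_of_nonneg ρ hρ.1.nonneg).mpr (QState.le_one ⟨ρ, hρ⟩)

instance : SecondCountableTopology (QState ι) :=
  have : SecondCountableTopology (Matrix ι ι ℂ) :=
    inferInstanceAs (SecondCountableTopology (ι → ι → ℂ))
  TopologicalSpace.Subtype.secondCountableTopology {ρ : Matrix ι ι ℂ | ρ.PosSemidef ∧ ρ.trace = 1}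

@[fun_prop]
theorem QState.continuous_apply {X : Type*} [TopologicalSpace X] {f : X → QState ι}
    (hf : Continuous f) (i j : ι) : Continuous fun x => (f x).1 i j :=
  hf.subtype_val.matrix_elem i j

end StateSpace

section DesignMoments

theorem map_sq_eq_sum_single {ι κ : Type} [Fintype ι] [DecidableEq ι] [Fintype κ] [DecidableEq κ]
    (T : Matrix ι ι ℂ →ₗ[ℂ] Matrix κ κ ℂ) (X : Matrix ι ι ℂ) :
    T X ^ 2 = ∑ p : ι × ι, ∑ q : ι × ι,
      (X p.1 p.2 * X q.1 q.2) • (T (.single p.1 p.2 1) * T (.single q.1 q.2 1)) := by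
  rw [map_eq_sum_single T X, ← Fintype.sum_prod_type', pow_two, Finset.sum_mul_sum]
  simp only [smul_mul_smul_comm]

namespace IsProjectiveTwoDesign

variable {ι : Type} [Fintype ι] [DecidableEq ι] {ν : Measure (QState ι)}

theorem nonempty (hν : IsProjectiveTwoDesign ν) : Nonempty ι := by
  have := hν.isProbabilityMeasure
  obtain ⟨ρ⟩ := nonempty_of_isProbabilityMeasure ν
  refine not_isEmpty_iff.mp fun _ => zero_ne_one (α := ℂ) ?_
  rw [← ρ.2.2, Matrix.trace_eq_zero_of_isEmpty]

theorem integral_apply (hν : IsProjectiveTwoDesign ν) (i j : ι) :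
    ∫ ρ, ρ.1 i j ∂ν = (if i = j then 1 else 0) / (Fintype.card ι : ℂ) := by
  have := hν.isProbabilityMeasure
  have := hν.nonempty
  have hcard : (Fintype.card ι : ℂ) ≠ 0 := by exact_mod_cast Fintype.card_ne_zero
  have hcard1 : (Fintype.card ι : ℂ) + 1 ≠ 0 := Nat.cast_add_one_ne_zero _
  have htrace (ρ : QState ι) : ρ.1 i j = ∑ k, ρ.1 i j * ρ.1 k k := by
    rw [← Finset.mul_sum, show ∑ k, ρ.1 k k = 1 from ρ.2.2, mul_one]
  have hint (k : ι) : Integrable (fun ρ : QState ι => ρ.1 i j * ρ.1 k k) ν :=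
    integrable_of_continuous (by fun_prop)
  have hflip (k : ι) : (if i = k ∧ k = j then 1 else 0 : ℂ) =
      if i = k then (if i = j then 1 else 0) else 0 := by grind
  rw [integral_congr_ae (.of_forall htrace), integral_finsetSum Finset.univ fun k _ => hint k]
  simp_rw [hν.integral_mul, hflip, and_true, ← Finset.sum_div, Finset.sum_add_distrib,
    Finset.sum_const, Finset.card_univ, nsmul_eq_mul, Finset.sum_ite_eq, Finset.mem_univ, if_true]
  field_simp

theorem integral_fst_mul_snd (hν : IsProjectiveTwoDesign ν) (i j k l : ι) :
    ∫ p, p.1.1 i j * p.2.1 k l ∂(ν.prod ν) =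
      (if i = j ∧ k = l then 1 else 0) / (Fintype.card ι : ℂ) ^ 2 := by
  have := hν.isProbabilityMeasure
  rw [integral_prod_mul (fun ρ : QState ι => ρ.1 i j) (fun ρ : QState ι => ρ.1 k l),
    hν.integral_apply, hν.integral_apply, div_mul_div_comm, ← pow_two, ite_zero_mul_ite_zero,
    mul_one]

theorem integral_sub_apply_mul_sub_apply (hν : IsProjectiveTwoDesign ν)
    (i j k l : ι) :
    ∫ p, (p.1.1 - p.2.1) i j * (p.1.1 - p.2.1) k l ∂(ν.prod ν) =
      2 / ((Fintype.card ι : ℂ) * (Fintype.card ι + 1)) *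
        ((if i = l ∧ k = j then 1 else 0) -
          (if i = j ∧ k = l then 1 else 0) / (Fintype.card ι : ℂ)) := by
  have := hν.isProbabilityMeasure
  have := hν.nonempty
  have hcard : (Fintype.card ι : ℂ) ≠ 0 := by exact_mod_cast Fintype.card_ne_zero
  have hcard1 : (Fintype.card ι : ℂ) + 1 ≠ 0 := Nat.cast_add_one_ne_zero _
  have hexpand (p : QState ι × QState ι) : (p.1.1 - p.2.1) i j * (p.1.1 - p.2.1) k l =
      (p.1.1 i j * p.1.1 k l + p.2.1 i j * p.2.1 k l) -
        (p.1.1 i j * p.2.1 k l + p.1.1 k l * p.2.1 i j) := by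
    simp only [Matrix.sub_apply]
    ring
  have hfst : ∫ p, p.1.1 i j * p.1.1 k l ∂(ν.prod ν) = ∫ ρ, ρ.1 i j * ρ.1 k l ∂ν := by
    rw [integral_fun_fst fun ρ : QState ι => ρ.1 i j * ρ.1 k l, probReal_univ, one_smul]
  have hsnd : ∫ p, p.2.1 i j * p.2.1 k l ∂(ν.prod ν) = ∫ ρ, ρ.1 i j * ρ.1 k l ∂ν := by
    rw [integral_fun_snd fun ρ : QState ι => ρ.1 i j * ρ.1 k l, probReal_univ, one_smul]
  simp_rw [hexpand]
  rw [integral_sub, integral_add, integral_add, hfst, hsnd, hν.integral_mul,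
    hν.integral_fst_mul_snd, hν.integral_fst_mul_snd, if_congr (and_comm (a := k = l)) rfl rfl]
  · field_simp
    ring
  all_goals exact integrable_of_continuous (by fun_prop)

theorem integral_trace_mul (hν : IsProjectiveTwoDesign ν) :
    ∫ p, (p.1.1 * p.2.1).trace.re ∂(ν.prod ν) = (Fintype.card ι : ℝ)⁻¹ := by
  have := hν.isProbabilityMeasure
  have := hν.nonempty
  have hcard : (Fintype.card ι : ℂ) ≠ 0 := by exact_mod_cast Fintype.card_ne_zero
  have htrace : ∫ p, (p.1.1 * p.2.1).trace ∂(ν.prod ν) = (Fintype.card ι : ℂ)⁻¹ := by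
    simp only [Matrix.trace, Matrix.diag_apply, Matrix.mul_apply, ← Fintype.sum_prod_type']
    rw [integral_finsetSum _ fun _ _ => integrable_of_continuous (by fun_prop)]
    simp_rw [hν.integral_fst_mul_snd, Fintype.sum_prod_type, and_iff_left_of_imp Eq.symm, ite_div,
      zero_div, Finset.sum_ite_eq, Finset.mem_univ, if_true, Finset.sum_const, Finset.card_univ,
      nsmul_eq_mul]
    field_simp
  have hre : ∫ p, (p.1.1 * p.2.1).trace.re ∂(ν.prod ν) =
      (∫ p, (p.1.1 * p.2.1).trace ∂(ν.prod ν)).re :=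
    integral_re (𝕜 := ℂ) (integrable_of_continuous (by fun_prop))
  rw [hre, htrace, ← Complex.ofReal_natCast, ← Complex.ofReal_inv, Complex.ofReal_re]

variable {κ : Type} [Fintype κ] [DecidableEq κ]

open scoped Matrix.Norms.L2Operator in
theorem integral_map_sub_sq (hν : IsProjectiveTwoDesign ν)
    (T : Matrix ι ι ℂ →ₗ[ℂ] Matrix κ κ ℂ) :
    ∫ p, T (p.1.1 - p.2.1) ^ 2 ∂(ν.prod ν) = secondMoment T := by
  have := hν.isProbabilityMeasure
  have := hν.nonempty
  have hcard : (Fintype.card ι : ℂ) ≠ 0 := by exact_mod_cast Fintype.card_ne_zero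
  have hcard1 : (Fintype.card ι : ℂ) + 1 ≠ 0 := Nat.cast_add_one_ne_zero _
  have hint (p q : ι × ι) : Integrable (fun s : QState ι × QState ι =>
      ((s.1.1 - s.2.1) p.1 p.2 * (s.1.1 - s.2.1) q.1 q.2) •
        (T (.single p.1 p.2 1) * T (.single q.1 q.2 1))) (ν.prod ν) :=
    integrable_of_continuous (by fun_prop)
  have hone : T 1 = ∑ i, T (.single i i 1) := by
    rw [← Matrix.sum_single_one, map_sum]
  simp_rw [map_sq_eq_sum_single]
  rw [integral_finsetSum _ fun p _ => integrable_finsetSum _ fun q _ => hint p q]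
  simp_rw [fun p => integral_finsetSum Finset.univ fun q _ => hint p q, integral_smul_const,
    hν.integral_sub_apply_mul_sub_apply, mul_sub, sub_smul, Finset.sum_sub_distrib]
  rw [secondMoment, partialTrace₂_choiState_sq, averageOutput, map_smul, hone]
  simp_rw [Fintype.sum_prod_type, ite_and, mul_ite, ite_smul, ite_div]
  simp only [mul_one, mul_zero, zero_smul, zero_div, inv_pow, one_div, Finset.mem_univ, if_true,
    Finset.sum_ite_eq, Finset.sum_ite_eq', Finset.sum_ite_irrel, Finset.sum_const_zero, mul_ite,
    ite_smul]
  simp_rw [pow_two, smul_mul_smul_comm, Finset.sum_mul_sum, ← Finset.smul_sum, smul_sub, smul_smul]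
  congr 2 <;> field_simp

end IsProjectiveTwoDesign

end DesignMoments

section Contraction

variable {ι κ : Type} [Fintype ι] [DecidableEq ι] [Fintype κ] [DecidableEq κ]
  {T : Matrix ι ι ℂ →ₗ[ℂ] Matrix κ κ ℂ}

theorem contractionRatio_nonneg (p : QState ι × QState ι) : 0 ≤ contractionRatio T p :=
  div_nonneg (traceDist_nonneg _ _) (traceDist_nonneg _ _)

theorem measurable_contractionRatio : Measurable (contractionRatio T) := by
  have hT : Continuous T := T.continuous_of_finiteDimensional
  have hdist {l : Type} [Fintype l] [DecidableEq l] {f g : QState ι × QState ι → Matrix l l ℂ}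
      (hf : Continuous f) (hg : Continuous g) : Continuous fun p => traceDist (f p) (g p) :=
    continuous_const.mul (continuous_traceNorm.comp (hf.sub hg))
  exact (hdist (by fun_prop) (by fun_prop)).measurable.div
    (hdist (by fun_prop) (by fun_prop)).measurable

namespace IsPositiveTracePreserving

theorem contractionRatio_le_one (hT : IsPositiveTracePreserving T) (p : QState ι × QState ι) :
    contractionRatio T p ≤ 1 := by
  refine div_le_one_of_le₀ ?_ (traceDist_nonneg _ _)
  rw [traceDist, traceDist, ← map_sub]
  gcongr
  exact hT.traceNorm_map_le (p.1.2.1.1.sub p.2.2.1.1)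

theorem integrable_contractionRatio (hT : IsPositiveTracePreserving T)
    (ω : Measure (QState ι × QState ι)) [IsFiniteMeasure ω] : Integrable (contractionRatio T) ω :=
  .of_mem_Icc 0 1 measurable_contractionRatio.aemeasurable
    (.of_forall fun p => ⟨contractionRatio_nonneg p, hT.contractionRatio_le_one p⟩)

/- With `s` the input and `t` the output distance, `t / s = t + (1 - s) (t / s) ≤ t + (1 - s)`. -/
theorem contractionRatio_le (hT : IsPositiveTracePreserving T) {p : QState ι × QState ι}
    (hp : IsIdempotentElem p.1.1) :
    contractionRatio T p ≤ 1 / 2 * traceNorm (T (p.1.1 - p.2.1)) + (p.1.1 * p.2.1).trace.re := by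
  have hsplit : contractionRatio T p ≤ traceDist (T p.1.1) (T p.2.1) +
      (1 - traceDist p.1.1 p.2.1) * contractionRatio T p := by
    rcases (traceDist_nonneg p.1.1 p.2.1).eq_or_lt with hdist | hdist
    · rw [← hdist, sub_zero, one_mul]
      exact le_add_of_nonneg_left (traceDist_nonneg _ _)
    · rw [contractionRatio, sub_mul, one_mul, mul_div_cancel₀ _ hdist.ne']
      linarith
  have hpure := one_sub_trace_mul_le_traceDist (σ := p.2) hp
  have htrace : 0 ≤ (p.1.1 * p.2.1).trace.re :=
    (Complex.le_def.mp (trace_mul_nonneg p.1.2.1 p.2.2.1)).1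
  have hratio := mul_le_mul_of_nonneg_right hpure (contractionRatio_nonneg (T := T) p)
  have hone := mul_le_mul_of_nonneg_left (hT.contractionRatio_le_one p) htrace
  rw [map_sub, ← traceDist]
  linarith

end IsPositiveTracePreserving

end Contraction

section Conditioning

theorem integral_cond_le {Ω : Type*} [MeasurableSpace Ω] {μ : Measure Ω} [IsProbabilityMeasure μ]
    {s : Set Ω} (hs : MeasurableSet s) {f : Ω → ℝ} (hf : Integrable f μ) (hf0 : 0 ≤ f)
    (hf1 : f ≤ 1) : ∫ ω, f ω ∂(ProbabilityTheory.cond μ s) ≤ ∫ ω, f ω ∂μ + μ.real sᶜ := by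
  have hcond : ∫ ω, f ω ∂(ProbabilityTheory.cond μ s) = (μ.real s)⁻¹ * ∫ ω in s, f ω ∂μ := by
    rw [ProbabilityTheory.cond, integral_smul_measure, ENNReal.toReal_inv, smul_eq_mul,
      Measure.real]
  have hrestrict : ∫ ω in s, f ω ∂μ ≤ ∫ ω, f ω ∂μ := setIntegral_le_integral hf (.of_forall hf0)
  have hmass : ∫ ω in s, f ω ∂μ ≤ μ.real s := by
    simpa using setIntegral_mono hf.integrableOn (integrable_const (1 : ℝ)).integrableOn hf1
  rw [hcond, probReal_compl_eq_one_sub hs]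
  rcases (measureReal_nonneg (μ := μ) (s := s)).eq_or_lt with hzero | hpos
  · rw [← hzero, inv_zero, zero_mul]
    linarith [integral_nonneg (μ := μ) hf0]
  · have hle : (μ.real s)⁻¹ * ∫ ω in s, f ω ∂μ ≤ 1 := (inv_mul_le_one₀ hpos).mpr hmass
    have hsplit : (μ.real s)⁻¹ * ∫ ω in s, f ω ∂μ =
        ∫ ω in s, f ω ∂μ + (1 - μ.real s) * ((μ.real s)⁻¹ * ∫ ω in s, f ω ∂μ) := by
      field_simp
      ring
    rw [hsplit]
    exact add_le_add hrestrict (mul_le_of_le_one_right (sub_nonneg.mpr measureReal_le_one) hle)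

end Conditioning

section AverageContraction

namespace IsProjectiveTwoDesign

variable {ι κ : Type} [Fintype ι] [DecidableEq ι] [Fintype κ] [DecidableEq κ]
  {ν : Measure (QState ι)} {T : Matrix ι ι ℂ →ₗ[ℂ] Matrix κ κ ℂ}

open scoped Matrix.Norms.L2Operator in
theorem integral_traceNorm_map_sub_le (hν : IsProjectiveTwoDesign ν)
    (hT : ∀ ⦃X : Matrix ι ι ℂ⦄, X.IsHermitian → (T X).IsHermitian) :
    ∫ p, traceNorm (T (p.1.1 - p.2.1)) ∂(ν.prod ν) ≤ traceSqrt (secondMoment T) := by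
  have := hν.isProbabilityMeasure
  have hTcont : Continuous T := T.continuous_of_finiteDimensional
  have hsq (p : QState ι × QState ι) :
      (T (p.1.1 - p.2.1)).conjTranspose * T (p.1.1 - p.2.1) = T (p.1.1 - p.2.1) ^ 2 := by
    rw [hT (p.1.2.1.1.sub p.2.2.1.1), pow_two]
  have hnorm (p : QState ι × QState ι) :
      traceNorm (T (p.1.1 - p.2.1)) = traceSqrt (T (p.1.1 - p.2.1) ^ 2) := by
    rw [traceNorm_eq_traceSqrt, hsq]
  have hint : Integrable (fun p => traceNorm (T (p.1.1 - p.2.1))) (ν.prod ν) :=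
    integrable_of_continuous (continuous_traceNorm.comp (by fun_prop))
  simp_rw [hnorm] at hint ⊢
  rw [← hν.integral_map_sub_sq]
  have hint_sq : Integrable (fun p => T (p.1.1 - p.2.1) ^ 2) (ν.prod ν) :=
    integrable_of_continuous (by fun_prop)
  refine integral_traceSqrt_le hint_sq hint (.of_forall fun p => ?_)
  rw [← hsq]
  exact (Matrix.posSemidef_conjTranspose_mul_self _).nonneg

theorem measureReal_eq_le (hν : IsProjectiveTwoDesign ν) :
    (ν.prod ν).real {p | p.1 = p.2} ≤ (Fintype.card ι : ℝ)⁻¹ := by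
  have := hν.isProbabilityMeasure
  rw [← hν.integral_trace_mul, ← one_mul ((ν.prod ν).real _)]
  refine le_trans ?_ (mul_meas_ge_le_integral_of_nonneg (.of_forall fun p => ?_)
    (integrable_of_continuous (by fun_prop)) 1)
  · rw [one_mul, one_mul]
    refine ENNReal.toReal_mono (measure_ne_top _ _) (measure_mono_ae ?_)
    filter_upwards [Measure.quasiMeasurePreserving_fst.ae hν.ae_isIdempotentElem] with p hp heq
    have heq : p.1 = p.2 := heq
    have htrace : (p.1.1 * p.2.1).trace = 1 := by rw [← heq, hp.eq, p.1.2.2]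
    exact (congrArg Complex.re htrace).ge
  · exact (Complex.le_def.mp (trace_mul_nonneg p.1.2.1 p.2.2.1)).1

theorem isProbabilityMeasure_pairDistribution [Nontrivial ι] (hν : IsProjectiveTwoDesign ν) :
    IsProbabilityMeasure (pairDistribution ν) := by
  have := hν.isProbabilityMeasure
  refine ProbabilityTheory.cond_isProbabilityMeasure fun hzero => ?_
  have hone : (ν.prod ν).real {p | p.1 = p.2} = 1 := by
    rw [Measure.real, (prob_compl_eq_zero_iff (measurableSet_eq_fun measurable_fst
      measurable_snd)).mp hzero, ENNReal.toReal_one]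
  have hcard : (Fintype.card ι : ℝ)⁻¹ < 1 :=
    inv_lt_one_of_one_lt₀ (by exact_mod_cast Fintype.one_lt_card)
  linarith [hν.measureReal_eq_le]

theorem avgContraction_le (hν : IsProjectiveTwoDesign ν) (hT : IsPositiveTracePreserving T) :
    avgContraction T (pairDistribution ν) ≤
      1 / 2 * traceSqrt (secondMoment T) + 2 / Fintype.card ι := by
  have := hν.isProbabilityMeasure
  have hTcont : Continuous T := T.continuous_of_finiteDimensional
  have hnorm : Integrable (fun p => 1 / 2 * traceNorm (T (p.1.1 - p.2.1))) (ν.prod ν) :=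
    integrable_of_continuous (continuous_const.mul (continuous_traceNorm.comp (by fun_prop)))
  have htrace : Integrable (fun p => (p.1.1 * p.2.1).trace.re) (ν.prod ν) :=
    integrable_of_continuous (by fun_prop)
  have hratio := hT.integrable_contractionRatio (ν.prod ν)
  have hne : MeasurableSet {p : QState ι × QState ι | p.1 ≠ p.2} :=
    (measurableSet_eq_fun measurable_fst measurable_snd).compl
  have hpure : ∀ᵐ p ∂(ν.prod ν), IsIdempotentElem p.1.1 :=
    Measure.quasiMeasurePreserving_fst.ae hν.ae_isIdempotentElem
  calc avgContraction T (pairDistribution ν)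
      ≤ ∫ p, contractionRatio T p ∂(ν.prod ν) + (ν.prod ν).real {p | p.1 ≠ p.2}ᶜ :=
        integral_cond_le hne hratio contractionRatio_nonneg hT.contractionRatio_le_one
    _ ≤ ∫ p, (1 / 2 * traceNorm (T (p.1.1 - p.2.1)) + (p.1.1 * p.2.1).trace.re) ∂(ν.prod ν) +
          (Fintype.card ι : ℝ)⁻¹ := by
        refine add_le_add (integral_mono_ae hratio (hnorm.add htrace) ?_) ?_
        · filter_upwards [hpure] with p hp using hT.contractionRatio_le hp
        · simpa only [ne_eq, Set.compl_ofPred, not_not] using hν.measureReal_eq_le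
    _ = 1 / 2 * ∫ p, traceNorm (T (p.1.1 - p.2.1)) ∂(ν.prod ν) + 2 / Fintype.card ι := by
        rw [integral_add hnorm htrace, integral_const_mul, hν.integral_trace_mul]
        ring
    _ ≤ 1 / 2 * traceSqrt (secondMoment T) + 2 / Fintype.card ι := by
        gcongr
        exact hν.integral_traceNorm_map_sub_le fun X => hT.isHermitian_map

end IsProjectiveTwoDesign

end AverageContraction

section ChannelPowContraction

variable {ι κ : Type} [Fintype ι] [DecidableEq ι] [Fintype κ] [DecidableEq κ]
  {Φ : Matrix ι ι ℂ →ₗ[ℂ] Matrix κ κ ℂ}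

theorem IsCompletelyPositive.posSemidef_smul_tensorPow_sub_tensorPow [Nonempty ι]
    (hΦ : IsCompletelyPositive Φ) (n : ℕ) :
    ((Fintype.card ι : ℂ) ^ n • tensorPow n (partialTrace₂ (choiState Φ ^ 2)) -
      tensorPow n (averageOutput Φ ^ 2)).PosSemidef := by
  have h := Matrix.le_iff.mp (averageOutput_sq_le (hΦ.posSemidef_choiState_channelPow n))
  rwa [partialTrace₂_choiState_channelPow_sq, averageOutput_channelPow, pow_two (tensorPow n _),
    tensorPow_mul, ← pow_two, Fintype.card_pi, Finset.prod_const, Finset.card_univ,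
    Fintype.card_fin, Nat.cast_pow] at h

theorem IsCompletelyPositive.traceSqrt_secondMoment_channelPow_le [Nonempty ι]
    (hΦ : IsCompletelyPositive Φ) (n : ℕ) :
    traceSqrt (secondMoment (channelPow n Φ)) ≤
      √2 * traceSqrt (partialTrace₂ (choiState Φ ^ 2)) ^ n := by
  have hτ := hΦ.posSemidef_choiState_channelPow n
  have hτ₂ := posSemidef_partialTrace₂ (hΦ.posSemidef_choiState.pow 2)
  calc traceSqrt (secondMoment (channelPow n Φ))
      ≤ traceSqrt ((2 : ℝ) • partialTrace₂ (choiState (channelPow n Φ) ^ 2)) :=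
        traceSqrt_mono (secondMoment_posSemidef hτ) (secondMoment_le hτ)
    _ = √2 * traceSqrt (partialTrace₂ (choiState Φ ^ 2)) ^ n := by
        rw [traceSqrt_smul zero_le_two (posSemidef_partialTrace₂ (hτ.pow 2)),
          partialTrace₂_choiState_channelPow_sq, traceSqrt_tensorPow hτ₂]

theorem IsProjectiveTwoDesign.avgContraction_channelPow_le {n : ℕ}
    {ν : Measure (QState (Fin n → ι))} (hν : IsProjectiveTwoDesign ν) (hΦ : IsQuantumChannel Φ) :
    avgContraction (channelPow n Φ) (pairDistribution ν) ≤
      1 / 2 * traceSqrt (secondMoment (channelPow n Φ)) + 2 / (Fintype.card ι : ℝ) ^ n := by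
  simpa using hν.avgContraction_le (hΦ.isPositiveTracePreserving_channelPow n)

theorem IsProjectiveTwoDesign.avgContraction_channelPow_le_traceSqrt_pow [Nonempty ι] {n : ℕ}
    {ν : Measure (QState (Fin n → ι))} (hν : IsProjectiveTwoDesign ν) (hΦ : IsQuantumChannel Φ) :
    avgContraction (channelPow n Φ) (pairDistribution ν) ≤
      1 / √2 * traceSqrt (partialTrace₂ (choiState Φ ^ 2)) ^ n +
        2 / (Fintype.card ι : ℝ) ^ n := by
  have hsqrt : (1 / √2 : ℝ) = 1 / 2 * √2 := by
    rw [div_mul_eq_mul_div, one_mul, Real.sqrt_div_self']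
  rw [hsqrt, mul_assoc]
  grw [hν.avgContraction_channelPow_le hΦ,
    hΦ.completelyPositive.traceSqrt_secondMoment_channelPow_le n]

theorem mul_pow_add_mul_pow_le {a b s t : ℝ} (ha : 0 ≤ a) (hb : 0 ≤ b) (hs : 0 ≤ s) (ht : 0 ≤ t)
    (n : ℕ) : a * s ^ n + b * t ^ n ≤ (a + b) * max s t ^ n := by
  rw [add_mul]
  gcongr
  exacts [le_max_left s t, le_max_right s t]

theorem exists_avgContraction_channelPow_le_mul_pow [Nontrivial ι] (hΦ : IsQuantumChannel Φ)
    (htrace : traceSqrt (partialTrace₂ (choiState Φ ^ 2)) < 1) :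
    ∃ K c : ℝ, 0 < c ∧ c < 1 ∧
      ∀ (n : ℕ) (ν : Measure (QState (Fin n → ι))), IsProjectiveTwoDesign ν →
        avgContraction (channelPow n Φ) (pairDistribution ν) ≤ K * c ^ n := by
  have hcard : (1 : ℝ) < Fintype.card ι := by exact_mod_cast Fintype.one_lt_card
  have hinv : 0 < (Fintype.card ι : ℝ)⁻¹ := by positivity
  refine ⟨1 / √2 + 2, max _ _, hinv.trans_le (le_max_right _ _),
    max_lt htrace (inv_lt_one_of_one_lt₀ hcard), fun n ν hν => ?_⟩
  grw [hν.avgContraction_channelPow_le_traceSqrt_pow hΦ,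
    ← mul_pow_add_mul_pow_le (by positivity) zero_le_two (traceSqrt_nonneg _) hinv.le,
    inv_pow, div_eq_mul_inv 2]

theorem mainTheorem8_general [Nontrivial ι] (hΦ : IsQuantumChannel Φ) :
    (∀ n : ℕ, 1 ≤ n → ∀ ν : Measure (QState (Fin n → ι)), IsProjectiveTwoDesign ν →
      ((Fintype.card ι : ℂ) ^ n • tensorPow n (partialTrace₂ (choiState Φ ^ 2)) -
        tensorPow n (averageOutput Φ ^ 2)).PosSemidef ∧
      IsProbabilityMeasure (pairDistribution ν) ∧
      Integrable (contractionRatio (channelPow n Φ)) (pairDistribution ν) ∧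
      avgContraction (channelPow n Φ) (pairDistribution ν) ≤
        1 / 2 * traceSqrt ((2 / ((Fintype.card ι : ℂ) ^ n + 1)) •
          ((Fintype.card ι : ℂ) ^ n • tensorPow n (partialTrace₂ (choiState Φ ^ 2)) -
            tensorPow n (averageOutput Φ ^ 2))) + 2 / (Fintype.card ι : ℝ) ^ n ∧
      avgContraction (channelPow n Φ) (pairDistribution ν) ≤
        1 / √2 * traceSqrt (partialTrace₂ (choiState Φ ^ 2)) ^ n +
          2 / (Fintype.card ι : ℝ) ^ n) ∧
    (traceSqrt (partialTrace₂ (choiState Φ ^ 2)) < 1 →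
      ∃ K c : ℝ, 0 < c ∧ c < 1 ∧ ∀ n : ℕ, 1 ≤ n →
        ∀ ν : Measure (QState (Fin n → ι)), IsProjectiveTwoDesign ν →
          avgContraction (channelPow n Φ) (pairDistribution ν) ≤ K * c ^ n) := by
  refine ⟨fun n hn ν hν => ?_, fun htrace => ?_⟩
  · have := Fin.pos_iff_nonempty.mp hn
    have hprob := hν.isProbabilityMeasure_pairDistribution
    rw [← secondMoment_channelPow]
    exact ⟨hΦ.completelyPositive.posSemidef_smul_tensorPow_sub_tensorPow n, hprob,
      (hΦ.isPositiveTracePreserving_channelPow n).integrable_contractionRatio _,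
      hν.avgContraction_channelPow_le hΦ, hν.avgContraction_channelPow_le_traceSqrt_pow hΦ⟩
  · obtain ⟨K, c, hc0, hc1, hdecay⟩ := exists_avgContraction_channelPow_le_mul_pow hΦ htrace
    exact ⟨K, c, hc0, hc1, fun n _ ν => hdecay n ν⟩

end ChannelPowContraction

end QContraction

theorem mainTheorem8 :
    (∃ C : ℝ, ∀ d n : ℕ, 2 ≤ d → 1 ≤ n →
      ∀ Φ : Matrix (Fin d) (Fin d) ℂ →ₗ[ℂ] Matrix (Fin d) (Fin d) ℂ, IsQuantumChannel Φ →
      ∀ ν : Measure (QState (Fin n → Fin d)), IsStateDesign 2 ν →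
        (((d : ℂ) ^ n) • tensorPow n (partialTrace₂ (choiState Φ ^ 2))
            - tensorPow n (averageOutput Φ ^ 2)).PosSemidef ∧
        IsProbabilityMeasure (pairDistribution ν) ∧
        Integrable (contractionRatio (channelPow n Φ)) (pairDistribution ν) ∧
        avgContraction (channelPow n Φ) (pairDistribution ν) ≤
          1 / 2 * traceSqrt ((2 / ((d : ℂ) ^ n + 1)) •
            (((d : ℂ) ^ n) • tensorPow n (partialTrace₂ (choiState Φ ^ 2))
              - tensorPow n (averageOutput Φ ^ 2)))
          + C / √((d : ℝ) ^ n) ∧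
        avgContraction (channelPow n Φ) (pairDistribution ν) ≤
          1 / √2 * traceSqrt (partialTrace₂ (choiState Φ ^ 2)) ^ n + C / √((d : ℝ) ^ n)) ∧
    (∀ d : ℕ, 2 ≤ d →
      ∀ Φ : Matrix (Fin d) (Fin d) ℂ →ₗ[ℂ] Matrix (Fin d) (Fin d) ℂ, IsQuantumChannel Φ →
      traceSqrt (partialTrace₂ (choiState Φ ^ 2)) < 1 →
      ∃ K c : ℝ, 0 < c ∧ c < 1 ∧ ∀ n : ℕ, 1 ≤ n →
        ∀ ν : Measure (QState (Fin n → Fin d)), IsStateDesign 2 ν →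
          avgContraction (channelPow n Φ) (pairDistribution ν) ≤ K * c ^ n) := by
  constructor
  · refine ⟨2, fun d n hd hn Φ hΦ ν hν => ?_⟩
    have := Fin.nontrivial_iff_two_le.mpr hd
    have hone : 1 ≤ (d : ℝ) ^ n := one_le_pow₀ (by exact_mod_cast one_le_two.trans hd)
    have hsqrt : √((d : ℝ) ^ n) ≤ (d : ℝ) ^ n :=
      Real.sqrt_le_iff.mpr ⟨by positivity, le_self_pow₀ hone two_ne_zero⟩
    obtain ⟨hpos, hprob, hint, hmoment, htrace⟩ :=
      (mainTheorem8_general hΦ).1 n hn ν hν.isProjectiveTwoDesign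
    rw [Fintype.card_fin] at hpos hmoment htrace
    exact ⟨hpos, hprob, hint, hmoment.trans (by gcongr), htrace.trans (by gcongr)⟩
  · intro d hd Φ hΦ ht
    have := Fin.nontrivial_iff_two_le.mpr hd
    obtain ⟨K, c, hc0, hc1, hdecay⟩ := (mainTheorem8_general hΦ).2 ht
    exact ⟨K, c, hc0, hc1, fun n hn ν hν => hdecay n hn ν hν.isProjectiveTwoDesign⟩
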